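/- Let $q,d_v,d_c\ge 1$ be integers. For a nonnegative integer $N$ and $x\in\mathbb Z_q^N$ (residues represented by $0,\dots,q-1$) let $\mathrm{wt}_L(x)=\sum_k\min(x_k,q-x_k)$ be the Lee weight of $x$; if $N\ge1$, its Lee type is the tuple $\theta_x=(\theta_x(0),\dots,\theta_x(\lfloor q/2\rfloor))$, where $\theta_x(\ell)$ is the fraction of entries of Lee weight $\ell$. Let $\mathcal T(\mathbb Z_q^N)$ be the set of Lee types of vectors of length $N$, $H(\theta)=-\sum_\ell\theta(\ell)\log_2\theta(\ell)$ (with $0\log_2 0=0$), and let $\widehat\theta$ be the fraction of entries whose Lee weight is attained by two residues: $\widehat\theta=1-\theta(0)$ for $q$ odd, $\widehat\theta=1-\theta(0)-\theta(q/2)$ for $q$ even. For a divisor $d$ of $q$, let $\mathcal O_d=\{du: u\in\mathbb Z_q^\times\}$ and $\theta(\mathcal O_d)=\sum_{0\le a\le\lfloor q/2\rfloor,\ a\in\mathcal O_d}\theta(a)$. The random $(d_v,d_c)$-regular LDPC ensemble of length $n$ over $\mathbb Z_q$, defined when $d_c\mid nd_v$, is the following. Put $m=nd_v/d_c$. The $nd_v$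 edge sockets of $n$ variable nodes ($d_v$ each) are joined to the $md_c$ edge sockets of $m$ check nodes ($d_c$ each) by a uniformly random bijection $\Pi$, and the edges carry independent uniformly random labels in $\mathbb Z_q^\times$. The parity-check matrix $\mathbf H\in\mathbb Z_q^{m\times n}$ has as entry $(j,i)$ the sum of the labels of the edges joining variable node $i$ and check node $j$, and $\mathcal C=\ker\mathbf H$. For $c\in\mathbb Z_q^n$ let $z\in\mathbb Z_q^{nd_v}$ be obtained by repeating each $c_i$ $d_v$ times, multiplying each copy by its edge label and permuting by $\Pi$; then $c\in\mathcal C$ if and only if, at each check node, the $d_c$ incoming entries of $z$ sum to $0$ ("$z$ satisfies the checks"). Let $c$ be uniform on $\mathbb Z_q^n$ and independent of the ensemble, and put $$f^{(n)}(\omega\mid\theta)=\Pr(\theta_z=\omega\mid\theta_c=\theta),\qquad a^{(n)}(\omega)=\Pr(z\text{ satisfies the checks}\mid\theta_z=\omega).$$ Let $\overline A^{(n)}_\theta$ and $\overline W^{(n)}_\ell$ be the expected numbers of codewords of $\mathcal C$ of Lee type $\theta$ and of Lee weight $\ell$, respectively, and let $$\overline B^{(n)}_\theta=\binom{n}{n\theta}\Pr(z\text{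 satisfies the checks}\mid\theta_c=\theta).$$ For a nonnegative sequence $x_n$ let its growth rate be $\limsup_{n\to\infty}\frac1n\log_2x_n\in[-\infty,\infty]$, with $\log_20=-\infty$; lengths $n$ for which $x_n$ is undefined (no ensemble, or a conditioning event of probability zero) do not contribute. Denote by $\phi(\omega\mid\theta),\alpha(\omega),\mathcal A(\theta),\mathcal B(\theta)$ the growth rates of $f^{(n)}(\omega\mid\theta),a^{(n)}(\omega),\overline A^{(n)}_\theta,\overline B^{(n)}_\theta$, and, for real $\delta$, by $\mathcal W(\delta)$ the growth rate of $\overline W^{(n)}_{\delta n}$. Let $\mathcal T=\bigcup_{n\ge1}\mathcal T(\mathbb Z_q^n)$, and for $\theta\in\mathcal T$ let $\mathcal T_\theta=\bigcup_{n\ge1}\{\omega\in\mathcal T(\mathbb Z_q^{nd_v}):\omega(\mathcal O_d)=\theta(\mathcal O_d)\ \text{for all } d\mid q\}$. Then for every $\theta\in\mathcal T$ $$\mathcal B(\theta)\le H(\theta)+\sup_{\omega\in\mathcal T_\theta}\bigl(\phi(\omega\mid\theta)+\alpha(\omega)\bigr),\qquad \mathcal A(\theta)\le H(\theta)+\widehat\theta+\sup_{\omega\in\mathcal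 T_\theta}\bigl(\phi(\omega\mid\theta)+\alpha(\omega)\bigr),$$ and for every real $\delta$ $$\mathcal W(\delta)\le\sup\Bigl\{\mathcal A(\theta):\theta\in\mathcal T,\ \sum_{\ell=1}^{\lfloor q/2\rfloor}\ell\,\theta(\ell)=\delta\Bigr\}.$$ -/

import Mathlib

open Filter

noncomputable section

namespace LeeLDPC

/-! ### Lee weight and Lee types -/

/-- Lee weight `min (a, q - a)` of a residue, represented in `{0, …, q - 1}`. -/
def leeWeight {q : ℕ} (a : ZMod q) : ℕ := min a.val (q - a.val)

/-- Lee weight of a vector. -/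
def vecLeeWeight {q : ℕ} {ι : Type*} [Fintype ι] (x : ι → ZMod q) : ℕ := ∑ k, leeWeight (x k)

/-- Tuples indexed by the possible Lee weights `0, …, ⌊q/2⌋`. -/
abbrev TypeVec (q : ℕ) : Type := Fin (q / 2 + 1) → ℝ

/-- Lee type of a vector: the fraction of entries of each Lee weight. -/
def leeType {q : ℕ} {ι : Type*} [Fintype ι] (x : ι → ZMod q) : TypeVec q :=
  fun l => ({k | leeWeight (x k) = (l : ℕ)} : Set ι).ncard / (Fintype.card ι : ℝ)

/-- The set of all Lee types of vectors of length `N` over `ℤ/q`. -/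
def leeTypes (q N : ℕ) : Set (TypeVec q) := {θ | ∃ x : Fin N → ZMod q, leeType x = θ}

/-- All Lee types, of vectors of any positive length. -/
def allLeeTypes (q : ℕ) : Set (TypeVec q) := {θ | ∃ N : ℕ, 1 ≤ N ∧ θ ∈ leeTypes q N}

/-- The weight per symbol of a Lee type: `n` times this is the Lee weight of a vector of length `n`
of that type. -/
def typeWeight {q : ℕ} (θ : TypeVec q) : ℝ := ∑ l : Fin (q / 2 + 1), ((l : ℕ) : ℝ) * θ l

/-- Entropy in bits. -/
def entropy {q : ℕ} (θ : TypeVec q) : ℝ := -∑ l, θ l * Real.logb 2 (θ l)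

/-- The fraction of entries whose Lee weight is attained by two residues. -/
def hatFrac {q : ℕ} (θ : TypeVec q) : ℝ :=
  if Odd q then 1 - θ 0 else 1 - θ 0 - θ (Fin.last (q / 2))

/-- The multinomial coefficient of `n` over the integers `n θ(0), …, n θ(⌊q/2⌋)`. -/
def typeMultinomial {q : ℕ} (n : ℕ) (θ : TypeVec q) : ℕ :=
  Nat.multinomial Finset.univ (fun l => ⌊(n : ℝ) * θ l⌋₊)

/-! ### Orbits under multiplication by units -/

open Classical in
/-- The fraction of entries in the orbit of `d` under multiplication by units. -/
def orbitFrac {q : ℕ} (θ : TypeVec q) (d : ℕ) : ℝ :=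
  ∑ l : Fin (q / 2 + 1),
    if ((l : ℕ) : ZMod q) ∈ MulAction.orbit (ZMod q)ˣ (d : ZMod q) then θ l else 0

/-- The Lee types of edge vectors of length `n dv` with the same orbit fractions as `θ`. -/
def edgeTypes {q : ℕ} (dv n : ℕ) (θ : TypeVec q) : Set (TypeVec q) :=
  {ω | ω ∈ leeTypes q (n * dv) ∧ ∀ d ∈ q.divisors, orbitFrac ω d = orbitFrac θ d}

/-- The same, for any positive block length. -/
def allEdgeTypes {q : ℕ} (dv : ℕ) (θ : TypeVec q) : Set (TypeVec q) :=
  {ω | ∃ n : ℕ, 1 ≤ n ∧ ω ∈ edgeTypes dv n θ}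

/-! ### The random regular ensemble -/

/-- An element of the regular ensemble of length `n`: a unit label for every one of the `n dv` edges
and a bijection from the edge sockets of the `n` variable nodes to the edge sockets of the
`m = n dv / dc` check nodes. There is none unless `dc` divides `n dv`. -/
abbrev Ensemble (q dv dc n : ℕ) : Type :=
  (Fin n × Fin dv → (ZMod q)ˣ) × (Fin n × Fin dv ≃ Fin (n * dv / dc) × Fin dc)

variable {q dv dc n : ℕ}

/-- The parity-check matrix: the entry at check `j` and variable `i` is the sum of the labels of the
edges that join them. -/
def parityCheck (x : Ensemble q dv dc n) : Matrix (Fin (n * dv / dc)) (Fin n) (ZMod q) :=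
  Matrix.of fun j i => ∑ s : Fin dv, if (x.2 (i, s)).1 = j then (x.1 (i, s) : ZMod q) else 0

/-- The code: the kernel of the parity-check matrix. -/
def code (x : Ensemble q dv dc n) : Submodule (ZMod q) (Fin n → ZMod q) :=
  LinearMap.ker (parityCheck x).mulVecLin

/-- The vector `z` seen by the check nodes: every entry of `c` is repeated `dv` times, each copy is
multiplied by its edge label, and the result is permuted. -/
def edgeVector (c : Fin n → ZMod q) (x : Ensemble q dv dc n) :
    Fin (n * dv / dc) × Fin dc → ZMod q :=
  fun e => (x.1 (x.2.symm e) : ZMod q) * c (x.2.symm e).1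

/-- The check equations: at each check node the incoming entries sum to zero. -/
def SatisfiesChecks {m : ℕ} (z : Fin m × Fin dc → ZMod q) : Prop :=
  ∀ j, ∑ k, z (j, k) = 0

theorem mem_code_iff (x : Ensemble q dv dc n) (c : Fin n → ZMod q) :
    c ∈ code x ↔ SatisfiesChecks (edgeVector c x) := by
  have key : ∀ j, (parityCheck x).mulVec c j = ∑ k, edgeVector c x (j, k) := by
    intro j
    have h1 : (parityCheck x).mulVec c j
        = ∑ p : Fin n × Fin dv, if (x.2 p).1 = j then (x.1 p : ZMod q) * c p.1 else 0 := by
      simp only [Matrix.mulVec, dotProduct, parityCheck, Matrix.of_apply, Finset.sum_mul,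
        ite_mul, zero_mul, Fintype.sum_prod_type]
    have h2 : (∑ p : Fin n × Fin dv, if (x.2 p).1 = j then (x.1 p : ZMod q) * c p.1 else 0)
        = ∑ e : Fin (n * dv / dc) × Fin dc, if e.1 = j then edgeVector c x e else 0 := by
      refine Fintype.sum_equiv x.2 _ _ fun p => ?_
      simp [edgeVector]
    rw [h1, h2, Fintype.sum_prod_type]
    rw [Finset.sum_eq_single j]
    · simp
    · intro b _ hb
      simp [hb]
    · simp
  simp only [code, LinearMap.mem_ker, Matrix.mulVecLin_apply, SatisfiesChecks]
  constructor
  · intro h j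
    rw [← key j, h]
    rfl
  · intro h
    funext j
    rw [key j, h j]
    rfl

/-- Uniform conditional probability `P(E | F)` on a finite sample space; zero when `F` is empty. -/
def condProb {Ω : Type*} (E F : Set Ω) : ℝ := (E ∩ F).ncard / (F.ncard : ℝ)

/-- The sample space: a uniform vector `c`, and independently a uniform element of the ensemble. -/
abbrev Experiment (q dv dc n : ℕ) : Type := (Fin n → ZMod q) × Ensemble q dv dc n

/-- The event that `c` has Lee type `θ`. -/
def inputType (dv dc n : ℕ) (θ : TypeVec q) : Set (Experiment q dv dc n) :=
  {p | leeType p.1 = θ}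

/-- The event that `z` has Lee type `ω`. -/
def outputType (dv dc n : ℕ) (ω : TypeVec q) : Set (Experiment q dv dc n) :=
  {p | leeType (edgeVector p.1 p.2) = ω}

/-- The event that `z` satisfies the check equations. -/
def checksHold (q dv dc n : ℕ) : Set (Experiment q dv dc n) :=
  {p | SatisfiesChecks (edgeVector p.1 p.2)}

/-- `P(z has type ω | c has type θ)`. -/
def typeTransition (dv dc n : ℕ) (ω θ : TypeVec q) : ℝ :=
  condProb (outputType dv dc n ω) (inputType dv dc n θ)

/-- `P(z satisfies the check equations | z has type ω)`. -/
def checkProb (dv dc n : ℕ) (ω : TypeVec q) : ℝ :=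
  condProb (checksHold q dv dc n) (outputType dv dc n ω)

/-- The number of codewords of Lee type `θ`. -/
def typeEnum (x : Ensemble q dv dc n) (θ : TypeVec q) : ℕ :=
  {c : Fin n → ZMod q | c ∈ code x ∧ leeType c = θ}.ncard

/-- The number of codewords of Lee weight `w`, for a real number `w`. -/
def weightEnum (x : Ensemble q dv dc n) (w : ℝ) : ℕ :=
  {c : Fin n → ZMod q | c ∈ code x ∧ (vecLeeWeight c : ℝ) = w}.ncard

/-- Average over the ensemble; zero if the ensemble is empty. -/
def ensembleAvg [NeZero q] (F : Ensemble q dv dc n → ℕ) : ℝ :=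
  (∑ x, (F x : ℝ)) / (Fintype.card (Ensemble q dv dc n) : ℝ)

/-- Average number of codewords of Lee type `θ`. -/
def avgTypeEnum [NeZero q] (dv dc n : ℕ) (θ : TypeVec q) : ℝ :=
  ensembleAvg fun x : Ensemble q dv dc n => typeEnum x θ

/-- Average number of codewords of Lee weight `w`. -/
def avgWeightEnum (q : ℕ) [NeZero q] (dv dc n : ℕ) (w : ℝ) : ℝ :=
  ensembleAvg fun x : Ensemble q dv dc n => weightEnum x w

/-- The multinomial coefficient of the type `θ`, i.e. the number of Lee weight patterns of that
type, times `P(z satisfies the check equations | c has type θ)`. -/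
def patternEnum (dv dc n : ℕ) (θ : TypeVec q) : ℝ :=
  typeMultinomial n θ * condProb (checksHold q dv dc n) (inputType dv dc n θ)

/-! ### Growth rates -/

/-- The exponential growth rate `limsup (1/n) log₂ (a n)`, with `log₂ 0 = -∞`. Lengths at which the
quantity vanishes, in particular those at which the type or the ensemble does not exist, therefore
do not contribute. -/
def growthRate (a : ℕ → ℝ) : EReal :=
  limsup (fun n : ℕ => if a n = 0 then (⊥ : EReal) else ((Real.logb 2 (a n) / n : ℝ) : EReal)) atTop

/-- `φ(ω | θ)`. -/
def phi (dv dc : ℕ) (ω θ : TypeVec q) : EReal := growthRate fun n => typeTransition dv dc n ω θ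

/-- `α(ω)`. -/
def alpha (dv dc : ℕ) (ω : TypeVec q) : EReal := growthRate fun n => checkProb dv dc n ω

/-- Growth rate of the average Lee type enumerator. -/
def typeGrowth [NeZero q] (dv dc : ℕ) (θ : TypeVec q) : EReal :=
  growthRate fun n => avgTypeEnum dv dc n θ

/-- Growth rate of the average Lee weight enumerator at weight `δ n`. -/
def weightGrowth (q : ℕ) [NeZero q] (dv dc : ℕ) (δ : ℝ) : EReal :=
  growthRate fun n => avgWeightEnum q dv dc n (δ * n)

end LeeLDPC

end

/-!
Write `T n θ` for the number of vectors of length `n` and Lee type `θ`.  Two symmetries reduce the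
claim to counting.  Vectors of the same Lee type differ by a permutation of the positions and by
signs.  Letting these act on the check sockets shows that, given its type, the edge vector is
uniform on the type class, whatever the input (`ncard_edgeVector_mul`); letting them act on the
variable nodes shows that `f(ω | θ)` is the fraction of labelings that send one fixed vector of type
`θ` to type `ω` (`typeTransition_eq`).  The first gives
`P(checks | θ) = ∑ ω, f(ω | θ) a(ω)` (`condProb_checksHold_eq_sum`), a sum with polynomially many
terms, each of whose types has the orbit fractions of `θ` (`leeType_edgeVector_mem`).

The difficulty is that the growth rates are taken for each type separately, whereas the dominant
`ω` in this sum varies with `n`, so that a uniform comparison is needed.  It comes from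
concatenating `k` blocks of length `n`: `f` and `T` are supermultiplicative
(`typeTransition_pow_le`, `ncard_typeClass_pow_le`), and so is `a` up to a factor polynomial in `n`
per block (`checkProb_pow_le`).  The latter is a quotient of a supermultiplicative count by the size
of a type class, and that size is `2 ^ (n * classRate θ)` up to a polynomial factor
(`ncard_typeClass_le`, `two_rpow_classRate_le`).  Letting `k` tend to infinity, the value at every
single length `n` is bounded by the growth rate of the same type, up to a factor polynomial in `n`
(`le_phi`, `le_alpha`, `le_typeGrowth`).  The bounds for `patternEnum` and `avgTypeEnum` follow
with the multinomial coefficient and `T n θ` bounded by their exponential rates.  The same uniform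
comparison applied to `avgTypeEnum` gives the bound on the weight enumerator, which is a sum of
type enumerators with polynomially many terms.
-/

noncomputable section

namespace LeeLDPC

/-! ### Lee types -/

section Types

variable {q : ℕ}

theorem leeWeight_le [NeZero q] (a : ZMod q) : leeWeight a ≤ q / 2 := by
  have := ZMod.val_lt a
  unfold leeWeight
  omega

/-- The Lee weight as an index of the entries of a Lee type. -/
def leeIndex [NeZero q] (a : ZMod q) : Fin (q / 2 + 1) :=
  ⟨leeWeight a, Nat.lt_succ_of_le (leeWeight_le a)⟩

theorem leeIndex_neg [NeZero q] (a : ZMod q) : leeIndex (-a) = leeIndex a := by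
  have h := ZMod.val_lt a
  by_cases ha : a = 0
  · simp [ha]
  · have : a.val ≠ 0 := by simpa using ha
    simp only [leeIndex, leeWeight, ZMod.neg_val, if_neg ha, Fin.mk.injEq]
    omega

theorem eq_or_eq_neg_of_leeIndex_eq [NeZero q] {a b : ZMod q} (h : leeIndex a = leeIndex b) :
    a = b ∨ a = -b := by
  have ha := ZMod.val_lt a
  have hb := ZMod.val_lt b
  simp only [leeIndex, leeWeight, Fin.mk.injEq] at h
  by_cases hab : a.val = b.val
  · exact Or.inl (ZMod.val_injective q hab)
  · right
    have h1 : a.val + b.val = q := by omega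
    have h2 : ((a.val + b.val : ℕ) : ZMod q) = 0 := by rw [h1]; simp
    rw [Nat.cast_add, ZMod.natCast_zmod_val, ZMod.natCast_zmod_val] at h2
    exact eq_neg_of_add_eq_zero_left h2

theorem exists_unit_mul_of_leeIndex_eq [NeZero q] {a b : ZMod q} (h : leeIndex a = leeIndex b) :
    ∃ u : (ZMod q)ˣ, (∀ c : ZMod q, leeIndex ((u : ZMod q) * c) = leeIndex c) ∧ a = u * b := by
  rcases eq_or_eq_neg_of_leeIndex_eq h with h | h
  · exact ⟨1, by simp, by simpa using h⟩
  · exact ⟨-1, by simp [leeIndex_neg], by simpa using h⟩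

/-- The number of entries of each Lee weight. -/
def leeCount [NeZero q] {ι : Type*} [Fintype ι] (x : ι → ZMod q) (l : Fin (q / 2 + 1)) : ℕ :=
  (Finset.univ.filter fun k => leeIndex (x k) = l).card

variable {ι ι' κ : Type*} [Fintype ι] [Fintype ι'] [Fintype κ]

theorem leeType_apply [NeZero q] (x : ι → ZMod q) (l : Fin (q / 2 + 1)) :
    leeType x l = (leeCount x l : ℝ) / Fintype.card ι := by
  rw [leeType, leeCount, ← Set.ncard_coe_finset]
  congr 3
  ext k
  simp [leeIndex, Fin.ext_iff]

theorem sum_leeCount [NeZero q] (x : ι → ZMod q) : ∑ l, leeCount x l = Fintype.card ι := by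
  simp only [leeCount]
  rw [← Finset.card_eq_sum_card_fiberwise (f := fun k => leeIndex (x k)) (by simp)]
  rfl

theorem leeCount_le [NeZero q] (x : ι → ZMod q) (l : Fin (q / 2 + 1)) :
    leeCount x l ≤ Fintype.card ι := Finset.card_le_univ _

theorem leeType_mul_card [NeZero q] (x : ι → ZMod q) (l : Fin (q / 2 + 1)) :
    (Fintype.card ι : ℝ) * leeType x l = leeCount x l := by
  rw [leeType_apply]
  rcases Nat.eq_zero_or_pos (Fintype.card ι) with h | h
  · have := leeCount_le x l
    have h0 : leeCount x l = 0 := by omega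
    simp [h, h0]
  · field_simp

theorem leeType_eq_iff [NeZero q] (x y : ι → ZMod q) :
    leeType x = leeType y ↔ ∀ l, leeCount x l = leeCount y l := by
  constructor
  · intro h l
    have := leeType_mul_card x l
    rw [h, leeType_mul_card y l] at this
    exact_mod_cast this.symm
  · intro h
    funext l
    rw [leeType_apply, leeType_apply, h]

theorem leeType_nonneg [NeZero q] (x : ι → ZMod q) (l : Fin (q / 2 + 1)) : 0 ≤ leeType x l := by
  rw [leeType_apply]; positivity

theorem sum_leeType [NeZero q] [Nonempty ι] (x : ι → ZMod q) : ∑ l, leeType x l = 1 := by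
  simp only [leeType_apply]
  rw [← Finset.sum_div, ← Nat.cast_sum, sum_leeCount]
  exact div_self (by exact_mod_cast Fintype.card_ne_zero)

theorem leeCount_comp_equiv [NeZero q] (e : ι' ≃ ι) (x : ι → ZMod q) (l : Fin (q / 2 + 1)) :
    leeCount (fun k => x (e k)) l = leeCount x l := by
  refine Finset.card_equiv e fun k => ?_
  simp

theorem leeType_comp_equiv [NeZero q] (e : ι' ≃ ι) (x : ι → ZMod q) :
    leeType (fun k => x (e k)) = leeType x := by
  funext l
  rw [leeType_apply, leeType_apply, leeCount_comp_equiv, Fintype.card_congr e]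

theorem leeType_prod [NeZero q] [Nonempty κ] {θ : TypeVec q} (x : κ → ι → ZMod q)
    (h : ∀ k, leeType (x k) = θ) : leeType (fun p : κ × ι => x p.1 p.2) = θ := by
  funext l
  have hc : (leeCount (fun p : κ × ι => x p.1 p.2) l : ℝ)
      = Fintype.card κ * (Fintype.card ι * θ l) := by
    have : leeCount (fun p : κ × ι => x p.1 p.2) l = ∑ k, leeCount (x k) l := by
      simp only [leeCount, Finset.card_filter, Fintype.sum_prod_type]
    rw [this, Nat.cast_sum]
    simp_rw [← leeType_mul_card, h]
    simp
  have h0 : (Fintype.card κ : ℝ) ≠ 0 := by exact_mod_cast Fintype.card_ne_zero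
  rw [leeType_apply, hc, Fintype.card_prod, Nat.cast_mul, mul_div_mul_left _ _ h0]
  obtain ⟨k⟩ := ‹Nonempty κ›
  rcases Nat.eq_zero_or_pos (Fintype.card ι) with hN | hN
  · rw [← h k, leeType_apply, hN]; simp
  · field_simp

/-- Two vectors of the same Lee type differ by a permutation of the positions and by
weight-preserving units. -/
theorem exists_perm_of_leeType_eq [NeZero q] {x y : ι → ZMod q} (h : leeType x = leeType y) :
    ∃ (σ : Equiv.Perm ι) (u : ι → (ZMod q)ˣ),
      (∀ k (c : ZMod q), leeIndex ((u k : ZMod q) * c) = leeIndex c) ∧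
      ∀ k, y k = u k * x (σ k) := by
  rw [leeType_eq_iff] at h
  have e : ∀ l, {k // leeIndex (y k) = l} ≃ {k // leeIndex (x k) = l} := fun l =>
    Fintype.equivOfCardEq (by
      rw [Fintype.card_subtype, Fintype.card_subtype]; exact (h l).symm)
  have hσ : ∀ k, leeIndex (y k) = leeIndex (x (Equiv.ofFiberEquiv e k)) := fun k =>
    (Equiv.ofFiberEquiv_map e k).symm
  choose u hu hy using fun k => exists_unit_mul_of_leeIndex_eq (hσ k)
  exact ⟨Equiv.ofFiberEquiv e, u, hu, hy⟩

/-- The finitely many Lee types of vectors indexed by `ι`. -/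
def typesOf (q : ℕ) [NeZero q] (ι : Type*) [Fintype ι] : Finset (TypeVec q) := by
  classical exact Finset.univ.image fun x : ι → ZMod q => leeType x

theorem leeType_mem_typesOf [NeZero q] (x : ι → ZMod q) : leeType x ∈ typesOf q ι := by
  classical
  simp [typesOf]

theorem mem_typesOf [NeZero q] {θ : TypeVec q} :
    θ ∈ typesOf q ι ↔ ∃ x : ι → ZMod q, leeType x = θ := by
  classical
  simp [typesOf]

theorem card_typesOf_le [NeZero q] :
    (typesOf q ι).card ≤ (Fintype.card ι + 1) ^ (q / 2 + 1) := by
  classical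
  have hsub : typesOf q ι ⊆ Finset.univ.image
      fun k : Fin (q / 2 + 1) → Fin (Fintype.card ι + 1) =>
        fun l => ((k l : ℕ) : ℝ) / Fintype.card ι := by
    intro θ hθ
    obtain ⟨x, rfl⟩ := mem_typesOf.1 hθ
    refine Finset.mem_image.2 ⟨fun l => ⟨leeCount x l, Nat.lt_succ_of_le (leeCount_le x l)⟩,
      Finset.mem_univ _, ?_⟩
    funext l
    rw [leeType_apply]
  refine (Finset.card_le_card hsub).trans (Finset.card_image_le.trans ?_)
  simp

theorem vecLeeWeight_eq [NeZero q] (x : ι → ZMod q) :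
    (vecLeeWeight x : ℝ) = Fintype.card ι * typeWeight (leeType x) := by
  have h : vecLeeWeight x = ∑ l : Fin (q / 2 + 1), (l : ℕ) * leeCount x l := by
    simp only [leeCount, Finset.card_filter, Finset.mul_sum]
    rw [Finset.sum_comm]
    refine Finset.sum_congr rfl fun k _ => ?_
    simp only [mul_ite, mul_one, mul_zero, Finset.sum_ite_eq, Finset.mem_univ, if_true]
    rfl
  rw [h, typeWeight, Finset.mul_sum]
  push_cast
  refine Finset.sum_congr rfl fun l _ => ?_
  rw [← leeType_mul_card]; ring

/-- The Lee weight of `a`, read as a residue, is `a` or `-a`; hence orbit fractions are determined by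
the Lee type. -/
theorem leeWeight_mem_orbit_iff [NeZero q] (a b : ZMod q) :
    ((leeWeight a : ℕ) : ZMod q) ∈ MulAction.orbit (ZMod q)ˣ b ↔
      a ∈ MulAction.orbit (ZMod q)ˣ b := by
  have h : ((leeWeight a : ℕ) : ZMod q) = a ∨ ((leeWeight a : ℕ) : ZMod q) = -a := by
    unfold leeWeight
    rcases min_choice a.val (q - a.val) with h | h
    · left; rw [h, ZMod.natCast_zmod_val]
    · right; rw [h, Nat.cast_sub (ZMod.val_lt a).le, ZMod.natCast_zmod_val]; simp
  rcases h with h | h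
  · rw [h]
  · rw [h]
    have h1 : -a = (-1 : (ZMod q)ˣ) • a := by simp [Units.smul_def]
    rw [h1, ← MulAction.orbit_eq_iff, MulAction.orbit_smul, MulAction.orbit_eq_iff]

open Classical in
theorem orbitFrac_leeType [NeZero q] (x : ι → ZMod q) (d : ℕ) :
    orbitFrac (leeType x) d = ((Finset.univ.filter fun k =>
      x k ∈ MulAction.orbit (ZMod q)ˣ (d : ZMod q)).card : ℝ) / Fintype.card ι := by
  have h : (Finset.univ.filter fun k => x k ∈ MulAction.orbit (ZMod q)ˣ (d : ZMod q)).card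
      = ∑ l : Fin (q / 2 + 1),
        if ((l : ℕ) : ZMod q) ∈ MulAction.orbit (ZMod q)ˣ (d : ZMod q) then leeCount x l else 0 := by
    simp only [leeCount, Finset.card_filter]
    have : ∀ l : Fin (q / 2 + 1),
        (if ((l : ℕ) : ZMod q) ∈ MulAction.orbit (ZMod q)ˣ (d : ZMod q)
          then ∑ k, (if leeIndex (x k) = l then 1 else 0) else 0)
        = ∑ k, if leeIndex (x k) = l then
            (if ((l : ℕ) : ZMod q) ∈ MulAction.orbit (ZMod q)ˣ (d : ZMod q) then 1 else 0) else 0 := by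
      intro l; split_ifs <;> simp
    simp_rw [this]
    rw [Finset.sum_comm]
    refine Finset.sum_congr rfl fun k _ => ?_
    rw [Finset.sum_ite_eq]
    simp [leeIndex, leeWeight_mem_orbit_iff]
  rw [h, orbitFrac, Nat.cast_sum, Finset.sum_div]
  refine Finset.sum_congr rfl fun l _ => ?_
  split_ifs
  · rw [leeType_apply]
  · simp

end Types

/-! ### The size of a type class -/

/-- Sets of vectors that contain all concatenations of `k` blocks have at least the `k`-th power of
the number of blocks. -/
theorem ncard_pow_le_ncard {α ι ι' κ : Type*} [Finite α] [Finite ι'] [Fintype κ]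
    (A : Set (ι → α)) (B : Set (ι' → α))
    (e : ι' ≃ κ × ι) (h : ∀ x : κ → ι → α, (∀ k, x k ∈ A) → (fun i => x (e i).1 (e i).2) ∈ B) :
    A.ncard ^ Fintype.card κ ≤ B.ncard := by
  classical
  have hA : A.ncard ^ Fintype.card κ = Nat.card (κ → A) := by
    rw [Nat.card_fun, Nat.card_coe_set_eq, Nat.card_eq_fintype_card]
  rw [hA, ← Nat.card_coe_set_eq]
  refine Nat.card_le_card_of_injective
    (fun x => ⟨fun i => (x (e i).1 : ι → α) (e i).2, h (fun k => x k) fun k => (x k).2⟩) ?_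
  intro x y hxy
  funext k
  refine Subtype.ext (funext fun i => ?_)
  simpa using congrFun (congrArg Subtype.val hxy) (e.symm (k, i))

section TypeClass

variable {q : ℕ}

/-- The vectors of a given Lee type. -/
def typeClass (ι : Type*) [Fintype ι] (θ : TypeVec q) : Set (ι → ZMod q) := {x | leeType x = θ}

/-- The number of residues of a given Lee weight. -/
def leeMult (q : ℕ) [NeZero q] (l : Fin (q / 2 + 1)) : ℕ :=
  (Finset.univ.filter fun a : ZMod q => leeIndex a = l).card

theorem leeMult_pos [NeZero q] (l : Fin (q / 2 + 1)) : 0 < leeMult q l := by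
  refine Finset.card_pos.2 ⟨((l : ℕ) : ZMod q), ?_⟩
  have hl := l.2
  have hq := NeZero.pos q
  have hlt : (l : ℕ) < q ∨ q = 1 := by omega
  simp only [Finset.mem_filter, Finset.mem_univ, true_and, Fin.ext_iff, leeIndex, leeWeight]
  have : ((l : ℕ) : ZMod q).val = l := ZMod.val_natCast_of_lt (by omega)
  omega

theorem leeMult_le_two [NeZero q] (l : Fin (q / 2 + 1)) : leeMult q l ≤ 2 := by
  obtain ⟨a, ha⟩ := Finset.card_pos.1 (leeMult_pos l)
  simp only [Finset.mem_filter, Finset.mem_univ, true_and] at ha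
  have : (Finset.univ.filter fun b : ZMod q => leeIndex b = l) ⊆ {a, -a} := by
    intro b hb
    simp only [Finset.mem_filter, Finset.mem_univ, true_and] at hb
    simpa using eq_or_eq_neg_of_leeIndex_eq (hb.trans ha.symm)
  exact (Finset.card_le_card this).trans Finset.card_le_two

theorem leeMult_le_one [NeZero q] {l : Fin (q / 2 + 1)} (h : (l : ℕ) = 0 ∨ 2 * (l : ℕ) = q) :
    leeMult q l ≤ 1 := by
  refine Finset.card_le_one.2 fun a ha b hb => ?_
  simp only [Finset.mem_filter, Finset.mem_univ, true_and, Fin.ext_iff, leeIndex, leeWeight]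
    at ha hb
  have h1 := ZMod.val_lt a
  have h2 := ZMod.val_lt b
  exact ZMod.val_injective q (by omega)

/-- The exponential growth rate of the size of the type class of `θ`. -/
def classRate [NeZero q] (θ : TypeVec q) : ℝ :=
  ∑ l, θ l * (Real.logb 2 (leeMult q l) - Real.logb 2 (θ l))

/-- Equality holds too: `leeMult` is one at the weights `0` and `q / 2`, the latter for even `q`, and
two elsewhere. Only this direction is needed. -/
theorem classRate_le [NeZero q] {θ : TypeVec q} (h0 : ∀ l, 0 ≤ θ l) (h1 : ∑ l, θ l = 1) :
    classRate θ ≤ entropy θ + hatFrac θ := by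
  have hlog1 : ∀ l, (leeMult q l) ≤ 1 → Real.logb 2 (leeMult q l) = 0 := by
    intro l hl
    have := leeMult_pos l
    have : leeMult q l = 1 := by omega
    simp [this]
  have hlog2 : ∀ l, Real.logb 2 (leeMult q l) ≤ 1 := by
    intro l
    have h := Real.logb_le_logb_of_le (b := 2) (by norm_num)
      (by exact_mod_cast leeMult_pos l : (0 : ℝ) < leeMult q l)
      (by exact_mod_cast leeMult_le_two l : (leeMult q l : ℝ) ≤ 2)
    rwa [Real.logb_self_eq_one (by norm_num)] at h
  have hsum : ∑ l, θ l * Real.logb 2 (leeMult q l) ≤ hatFrac θ := by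
    unfold hatFrac
    have hz : ((0 : Fin (q / 2 + 1)) : ℕ) = 0 := rfl
    split_ifs with hq
    · rw [← h1, ← Finset.add_sum_erase _ θ (Finset.mem_univ 0),
        ← Finset.add_sum_erase _ _ (Finset.mem_univ 0), hlog1 0 (leeMult_le_one (Or.inl rfl))]
      have : ∑ l ∈ Finset.univ.erase 0, θ l * Real.logb 2 (leeMult q l)
          ≤ ∑ l ∈ Finset.univ.erase 0, θ l :=
        Finset.sum_le_sum fun l _ => mul_le_of_le_one_right (h0 l) (hlog2 l)
      linarith
    · rw [Nat.not_odd_iff_even] at hq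
      obtain ⟨r, hr⟩ := hq
      have hqpos := NeZero.pos q
      have hne : Fin.last (q / 2) ∈ (Finset.univ.erase (0 : Fin (q / 2 + 1))) := by
        simp only [Finset.mem_erase, Finset.mem_univ, and_true, ne_eq, Fin.ext_iff, Fin.val_last,
          hz]
        omega
      rw [← h1, ← Finset.add_sum_erase _ θ (Finset.mem_univ 0), ← Finset.add_sum_erase _ θ hne,
        ← Finset.add_sum_erase _ _ (Finset.mem_univ 0), ← Finset.add_sum_erase _ _ hne,
        hlog1 0 (leeMult_le_one (Or.inl rfl)),
        hlog1 (Fin.last (q / 2)) (leeMult_le_one (Or.inr (by rw [Fin.val_last]; omega)))]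
      have : ∑ l ∈ (Finset.univ.erase 0).erase (Fin.last (q / 2)), θ l * Real.logb 2 (leeMult q l)
          ≤ ∑ l ∈ (Finset.univ.erase 0).erase (Fin.last (q / 2)), θ l :=
        Finset.sum_le_sum fun l _ => mul_le_of_le_one_right (h0 l) (hlog2 l)
      linarith
  unfold classRate entropy
  simp only [mul_sub, Finset.sum_sub_distrib]
  linarith

/-- A weighted likelihood of a type, written as a power of two. The factors with `θ l = 0` have
exponent zero on both sides. -/
theorem prod_div_pow_eq_two_rpow {L : Type*} [Fintype L] {N : ℝ} {θ m : L → ℝ} {k : L → ℕ}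
    (hθ : ∀ l, 0 ≤ θ l) (hm : ∀ l, 0 < m l) (hk : ∀ l, N * θ l = k l) :
    ∏ l, (m l / θ l) ^ k l
      = (2 : ℝ) ^ (N * ∑ l, θ l * (Real.logb 2 (m l) - Real.logb 2 (θ l))) := by
  rw [Finset.mul_sum, Real.rpow_sum_of_pos (by norm_num)]
  refine Finset.prod_congr rfl fun l _ => ?_
  rw [← mul_assoc, hk l]
  rcases Nat.eq_zero_or_pos (k l) with h | h
  · simp [h]
  · have hpos : 0 < θ l := by
      refine lt_of_le_of_ne (hθ l) fun h0 => ?_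
      have := hk l
      rw [← h0, mul_zero] at this
      exact h.ne (by exact_mod_cast this)
    rw [← Real.logb_div (hm l).ne' hpos.ne', mul_comm, Real.rpow_mul (by norm_num),
      Real.rpow_logb (by norm_num) (by norm_num) (div_pos (hm l) hpos), Real.rpow_natCast]

variable {ι ι' κ : Type*} [Fintype ι] [Fintype ι'] [Fintype κ]

theorem prod_leeIndex [NeZero q] (p : Fin (q / 2 + 1) → ℝ) (x : ι → ZMod q) :
    ∏ i, p (leeIndex (x i)) = ∏ l, p l ^ leeCount x l := by
  rw [← Finset.prod_fiberwise_of_maps_to (t := Finset.univ) (g := fun i => leeIndex (x i))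
    (by simp)]
  refine Finset.prod_congr rfl fun l _ => ?_
  rw [Finset.prod_congr rfl (g := fun _ => p l), Finset.prod_const]
  · rfl
  · intro i hi
    rw [(Finset.mem_filter.1 hi).2]

theorem prod_eq_two_rpow_classRate [NeZero q] (x : ι → ZMod q) :
    ∏ l, ((leeMult q l : ℝ) / leeType x l) ^ leeCount x l
      = (2 : ℝ) ^ (Fintype.card ι * classRate (leeType x)) :=
  prod_div_pow_eq_two_rpow (leeType_nonneg x) (fun l => by exact_mod_cast leeMult_pos l)
    (leeType_mul_card x)

/-- The memoryless source under which all the vectors of the class are equally likely gives the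
whole class probability at most one. -/
theorem ncard_typeClass_le [NeZero q] [Nonempty ι] (θ : TypeVec q) :
    ((typeClass ι θ).ncard : ℝ) ≤ (2 : ℝ) ^ (Fintype.card ι * classRate θ) := by
  classical
  rcases (typeClass ι θ).eq_empty_or_nonempty with h | ⟨x, rfl⟩
  · rw [h]; simp; positivity
  set θ := leeType x with hθ
  -- `p (leeIndex a)` is the probability of the residue `a` under the source: its Lee weight has law
  -- `θ`, and the residues of each weight are equally likely.
  let p : Fin (q / 2 + 1) → ℝ := fun l => θ l / leeMult q l
  have hp0 : ∀ l, 0 ≤ p l := fun l => div_nonneg (leeType_nonneg x l) (Nat.cast_nonneg _)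
  have hp1 : ∑ a : ZMod q, p (leeIndex a) = 1 := by
    rw [← Finset.sum_fiberwise_of_maps_to (t := Finset.univ) (g := fun a : ZMod q => leeIndex a)
      (by simp), ← sum_leeType x]
    refine Finset.sum_congr rfl fun l _ => ?_
    rw [Finset.sum_congr rfl (g := fun _ => p l), Finset.sum_const, nsmul_eq_mul]
    · change (leeMult q l : ℝ) * (θ l / leeMult q l) = θ l
      have : (leeMult q l : ℝ) ≠ 0 := by exact_mod_cast (leeMult_pos l).ne'
      field_simp
    · intro i hi
      rw [(Finset.mem_filter.1 hi).2]
  have htot : ∑ y : ι → ZMod q, ∏ i, p (leeIndex (y i)) = 1 := by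
    have h := Finset.prod_univ_sum (fun _ : ι => (Finset.univ : Finset (ZMod q)))
      fun _ a => p (leeIndex a)
    rw [Fintype.piFinset_univ] at h
    rw [← h]
    simp [hp1]
  have hG : (2 : ℝ) ^ (Fintype.card ι * classRate θ) * ∏ l, p l ^ leeCount x l = 1 := by
    rw [← prod_eq_two_rpow_classRate, ← Finset.prod_mul_distrib]
    refine Finset.prod_eq_one fun l _ => ?_
    rw [← mul_pow]
    rcases Nat.eq_zero_or_pos (leeCount x l) with h | h
    · simp [h]
    · have h1 : (leeMult q l : ℝ) ≠ 0 := by exact_mod_cast (leeMult_pos l).ne'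
      have h2 : θ l ≠ 0 := by
        intro h0
        have := leeType_mul_card x l
        rw [← hθ, h0, mul_zero] at this
        exact h.ne (by exact_mod_cast this)
      have h3 : (leeMult q l : ℝ) / θ l * p l = 1 := by
        simp only [p]
        field_simp
      rw [← hθ, h3, one_pow]
  have hle : ((typeClass ι θ).ncard : ℝ) * ∏ l, p l ^ leeCount x l ≤ 1 := by
    have hcard : (typeClass ι θ).ncard
        = (Finset.univ.filter fun y : ι → ZMod q => leeType y = θ).card := by
      rw [← Set.ncard_coe_finset]
      congr 1
      ext y
      simp [typeClass]
    have hterm : ∀ y ∈ Finset.univ.filter (fun y : ι → ZMod q => leeType y = θ),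
        ∏ l, p l ^ leeCount x l ≤ ∏ i, p (leeIndex (y i)) := by
      intro y hy
      have hy' : leeType x = leeType y := (Finset.mem_filter.1 hy).2.symm
      rw [leeType_eq_iff] at hy'
      rw [prod_leeIndex]
      simp_rw [hy']
      exact le_rfl
    rw [← htot, hcard, ← nsmul_eq_mul, ← Finset.sum_const]
    exact (Finset.sum_le_sum hterm).trans
      (Finset.sum_le_univ_sum_of_nonneg fun y => Finset.prod_nonneg fun i _ => hp0 _)
  have hpos : (0 : ℝ) < 2 ^ (Fintype.card ι * classRate θ) := by positivity
  nlinarith [mul_le_mul_of_nonneg_left hle hpos.le]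

/-- The multinomial coefficient times the probability of a pattern is one term of the expansion of
`(∑ l, θ l) ^ n = 1`. -/
theorem typeMultinomial_le [NeZero q] [Nonempty ι] (x : ι → ZMod q) :
    (typeMultinomial (Fintype.card ι) (leeType x) : ℝ)
      ≤ (2 : ℝ) ^ (Fintype.card ι * entropy (leeType x)) := by
  have hfl : ∀ l, ⌊(Fintype.card ι : ℝ) * leeType x l⌋₊ = leeCount x l := fun l => by
    rw [leeType_mul_card, Nat.floor_natCast]
  have h1 : (2 : ℝ) ^ (Fintype.card ι * entropy (leeType x))
      = ∏ l, (1 / leeType x l) ^ leeCount x l := by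
    rw [prod_div_pow_eq_two_rpow (m := fun _ => 1) (leeType_nonneg x) (fun _ => one_pos)
      (leeType_mul_card x)]
    simp [entropy]
  have hterm : (typeMultinomial (Fintype.card ι) (leeType x) : ℝ)
      * ∏ l, leeType x l ^ leeCount x l ≤ 1 := by
    have hsum := Finset.sum_pow_eq_sum_piAntidiag Finset.univ (leeType x) (Fintype.card ι)
    rw [sum_leeType, one_pow] at hsum
    rw [hsum, typeMultinomial]
    simp_rw [hfl]
    refine Finset.single_le_sum (f := fun k : Fin (q / 2 + 1) → ℕ =>
      (Nat.multinomial Finset.univ k : ℝ) * ∏ l, leeType x l ^ k l) (fun k _ => ?_) ?_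
    · exact mul_nonneg (Nat.cast_nonneg _)
        (Finset.prod_nonneg fun l _ => pow_nonneg (leeType_nonneg x l) _)
    · simp [Finset.mem_piAntidiag, sum_leeCount]
  have hpos : 0 < ∏ l, leeType x l ^ leeCount x l := by
    refine Finset.prod_pos fun l _ => ?_
    rcases Nat.eq_zero_or_pos (leeCount x l) with h | h
    · simp [h]
    · refine pow_pos (lt_of_le_of_ne (leeType_nonneg x l) fun h0 => ?_) _
      have := leeType_mul_card x l
      rw [← h0, mul_zero] at this
      exact h.ne (by exact_mod_cast this)
  rw [h1]
  simp only [one_div, inv_pow, Finset.prod_inv_distrib]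
  rw [← one_div, le_div_iff₀ hpos]
  exact hterm

/-- A weight pattern has at least `N! / ∏ k_l!` rearrangements, and each is the pattern of
`∏ m_l ^ k_l` vectors. -/
theorem factorial_mul_prod_le [NeZero q] (x : ι → ZMod q) :
    (Fintype.card ι).factorial * ∏ l, leeMult q l ^ leeCount x l
      ≤ (typeClass ι (leeType x)).ncard * ∏ l, (leeCount x l).factorial := by
  classical
  let w : ι → Fin (q / 2 + 1) := fun i => leeIndex (x i)
  let P : Finset (ι → Fin (q / 2 + 1)) :=
    Finset.univ.image fun σ : Equiv.Perm ι => fun i => w (σ i)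
  have h1 : (Fintype.card ι).factorial ≤ (∏ l, (leeCount x l).factorial) * P.card := by
    rw [← Fintype.card_perm, ← Finset.card_univ]
    refine Finset.card_le_mul_card_image _ _ fun v hv => ?_
    obtain ⟨τ, -, rfl⟩ := Finset.mem_image.1 hv
    have hs := DomMulAct.stabilizer_card w
    have hk : ∀ l, Fintype.card {i // w i = l} = leeCount x l := fun l => by
      rw [Fintype.card_subtype]; rfl
    simp_rw [hk] at hs
    rw [← hs, Fintype.card_subtype]
    refine Finset.card_le_card_of_injOn (fun σ => τ.symm.trans σ) ?_ ?_
    · intro σ hσ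
      simp only [Finset.coe_filter, Finset.mem_univ, true_and, Set.mem_ofPred_eq] at hσ ⊢
      funext i
      simpa using congrFun hσ (τ.symm i)
    · intro σ _ σ' _ h
      ext i
      simpa using congrArg (fun e : Equiv.Perm ι => e (τ i)) h
  have h2 : P.card * ∏ l, leeMult q l ^ leeCount x l ≤ (typeClass ι (leeType x)).ncard := by
    rw [Set.ncard_eq_toFinset_card']
    refine le_trans (le_of_eq ?_) (Finset.card_le_card
      (Finset.filter_subset (fun y => (fun i => leeIndex (y i)) ∈ P) _))
    rw [← Finset.sum_card_fiberwise_eq_card_filter, ← smul_eq_mul, ← Finset.sum_const]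
    refine Finset.sum_congr rfl fun v hv => ?_
    obtain ⟨τ, -, rfl⟩ := Finset.mem_image.1 hv
    have hset : ((typeClass ι (leeType x)).toFinset.filter
        fun y => (fun i => leeIndex (y i)) = fun i => w (τ i))
        = Fintype.piFinset fun i => Finset.univ.filter fun a => leeIndex a = w (τ i) := by
      ext y
      simp only [Finset.mem_filter, Set.mem_toFinset, Fintype.mem_piFinset, Finset.mem_univ,
        true_and, funext_iff, and_iff_right_iff_imp]
      intro hy
      change leeType y = leeType x
      rw [← leeType_comp_equiv τ x, leeType_eq_iff]
      intro l
      simp only [leeCount, hy, w]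
    rw [hset, Fintype.card_piFinset]
    have h := prod_leeIndex (fun l => (leeMult q l : ℝ)) x
    have h' : ∏ i, leeMult q (leeIndex (x i)) = ∏ l, leeMult q l ^ leeCount x l := by
      exact_mod_cast h
    rw [← h', ← Equiv.prod_comp τ]
    rfl
  calc _ ≤ ((∏ l, (leeCount x l).factorial) * P.card) * ∏ l, leeMult q l ^ leeCount x l :=
        Nat.mul_le_mul_right _ h1
    _ = (∏ l, (leeCount x l).factorial) * (P.card * ∏ l, leeMult q l ^ leeCount x l) := by ring
    _ ≤ _ := by rw [mul_comm]; exact Nat.mul_le_mul_right _ h2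

/-- A weak form of Stirling's upper bound; the factor `k + 1` instead of `k` covers `k = 0`. -/
theorem factorial_le_mul_pow_mul_exp_neg (k : ℕ) :
    (k.factorial : ℝ) ≤ Real.exp 1 * (k + 1) * (k ^ k * Real.exp (-k)) := by
  have main : ∀ k : ℕ, ((k + 1).factorial : ℝ)
      ≤ Real.exp 1 * (k + 1) * ((k + 1) ^ (k + 1) * Real.exp (-(k + 1))) := by
    intro k
    induction k with
    | zero => simp [← Real.exp_add]
    | succ k ih =>
      have hk : (0 : ℝ) < k + 1 := by positivity
      -- `(1 - 1/(k+2)) ^ (k+2) ≤ 1/e`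
      have hle : ((k : ℝ) + 1) ^ (k + 2) ≤ (k + 2) ^ (k + 2) * Real.exp (-1) := by
        have h1 : ((k : ℝ) + 1) / (k + 2) ≤ Real.exp (-1 / (k + 2)) := by
          have h := Real.add_one_le_exp (-1 / ((k : ℝ) + 2))
          have h2 : -1 / ((k : ℝ) + 2) + 1 = (k + 1) / (k + 2) := by field_simp; ring
          rwa [h2] at h
        have h3 := pow_le_pow_left₀ (by positivity) h1 (k + 2)
        rw [← Real.exp_nat_mul, div_pow, div_le_iff₀ (by positivity)] at h3
        have h4 : ((k + 2 : ℕ) : ℝ) * (-1 / (k + 2)) = -1 := by push_cast; field_simp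
        rw [h4] at h3
        linarith
      have hexp : Real.exp (-((k : ℝ) + 1 + 1)) = Real.exp (-1) * Real.exp (-(k + 1)) := by
        rw [← Real.exp_add]; ring_nf
      rw [Nat.factorial_succ]
      push_cast
      calc ((k : ℝ) + 1 + 1) * ((k + 1).factorial : ℝ)
          ≤ (k + 1 + 1) * (Real.exp 1 * (k + 1) * ((k + 1) ^ (k + 1) * Real.exp (-(k + 1)))) := by
            gcongr
        _ = Real.exp 1 * (k + 1 + 1) * Real.exp (-(k + 1)) * (k + 1) ^ (k + 2) := by ring
        _ ≤ Real.exp 1 * (k + 1 + 1) * Real.exp (-(k + 1)) * ((k + 2) ^ (k + 2) * Real.exp (-1)) :=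
            by gcongr
        _ = _ := by rw [hexp]; ring
  rcases k with _ | k
  · simp
  · refine (main k).trans ?_
    push_cast
    gcongr
    linarith

/-- Up to a polynomial factor the type class is as large as its rate says. -/
theorem two_rpow_classRate_le [NeZero q] (x : ι → ZMod q) :
    (2 : ℝ) ^ (Fintype.card ι * classRate (leeType x))
      ≤ (3 * (Fintype.card ι + 1)) ^ (q / 2 + 1) * ((typeClass ι (leeType x)).ncard : ℝ) := by
  set N := Fintype.card ι with hN
  have hfac : ∀ l, ((leeMult q l : ℝ) / leeType x l) ^ leeCount x l ≤
      (leeMult q l : ℝ) ^ leeCount x l * ((N : ℝ) ^ leeCount x l) * Real.exp (-leeCount x l)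
        * ((leeCount x l).factorial : ℝ)⁻¹ * (3 * (N + 1)) := by
    intro l
    have hkN : (leeCount x l : ℝ) ≤ N := by exact_mod_cast leeCount_le x l
    have hst := factorial_le_mul_pow_mul_exp_neg (leeCount x l)
    set k := leeCount x l
    have hkk : (0 : ℝ) < (k : ℝ) ^ k := by
      rcases Nat.eq_zero_or_pos k with h | h
      · simp [h]
      · positivity
    have hfpos : (0 : ℝ) < k.factorial := by exact_mod_cast Nat.factorial_pos k
    have he : Real.exp 1 ≤ 3 := Real.exp_one_lt_d9.le.trans (by norm_num)
    have hst' : (k.factorial : ℝ) ≤ 3 * (N + 1) * (k ^ k * Real.exp (-k)) := by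
      refine hst.trans ?_
      gcongr
    have hinv : ((k : ℝ) ^ k)⁻¹ ≤ Real.exp (-k) * (k.factorial : ℝ)⁻¹ * (3 * (N + 1)) := by
      rw [← one_div, div_le_iff₀ hkk]
      calc (1 : ℝ) = k.factorial * (k.factorial : ℝ)⁻¹ := by field_simp
        _ ≤ (3 * (N + 1) * (k ^ k * Real.exp (-k))) * (k.factorial : ℝ)⁻¹ := by gcongr
        _ = _ := by ring
    rw [leeType_apply, div_div_eq_mul_div, div_pow, mul_pow, div_eq_mul_inv]
    calc (leeMult q l : ℝ) ^ k * (N : ℝ) ^ k * ((k : ℝ) ^ k)⁻¹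
        ≤ (leeMult q l : ℝ) ^ k * (N : ℝ) ^ k
          * (Real.exp (-k) * (k.factorial : ℝ)⁻¹ * (3 * (N + 1))) := by gcongr
      _ = _ := by ring
  have hcount : (∑ l, (leeCount x l)) = N := sum_leeCount x
  have hprod : ∏ l, ((leeMult q l : ℝ) ^ leeCount x l * ((N : ℝ) ^ leeCount x l)
        * Real.exp (-leeCount x l) * ((leeCount x l).factorial : ℝ)⁻¹ * (3 * (N + 1)))
      = (∏ l, (leeMult q l : ℝ) ^ leeCount x l) * (N : ℝ) ^ N * Real.exp (-N)
        * (∏ l, ((leeCount x l).factorial : ℝ))⁻¹ * (3 * (N + 1)) ^ (q / 2 + 1) := by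
    generalize 3 * ((N : ℝ) + 1) = c
    simp only [Finset.prod_mul_distrib, Finset.prod_inv_distrib, Finset.prod_pow_eq_pow_sum,
      hcount, ← Real.exp_sum, Finset.sum_neg_distrib, ← Nat.cast_sum, Finset.prod_const,
      Finset.card_univ, Fintype.card_fin]
  have hNN : (N : ℝ) ^ N * Real.exp (-N) ≤ N.factorial := by
    have h := Real.pow_div_factorial_le_exp (N : ℝ) (Nat.cast_nonneg N) N
    rw [div_le_iff₀ (by exact_mod_cast Nat.factorial_pos N)] at h
    rw [Real.exp_neg, ← div_eq_mul_inv, div_le_iff₀ (Real.exp_pos _)]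
    linarith
  have hcnt : (N.factorial : ℝ) * ∏ l, (leeMult q l : ℝ) ^ leeCount x l
      ≤ (typeClass ι (leeType x)).ncard * ∏ l, ((leeCount x l).factorial : ℝ) := by
    exact_mod_cast factorial_mul_prod_le x
  have hfp : (0 : ℝ) < ∏ l, ((leeCount x l).factorial : ℝ) :=
    Finset.prod_pos fun l _ => by exact_mod_cast Nat.factorial_pos _
  rw [← prod_eq_two_rpow_classRate]
  calc ∏ l, ((leeMult q l : ℝ) / leeType x l) ^ leeCount x l
      ≤ _ := Finset.prod_le_prod (fun l _ => pow_nonneg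
          (div_nonneg (Nat.cast_nonneg _) (leeType_nonneg x l)) _) fun l _ => hfac l
    _ = ((N : ℝ) ^ N * Real.exp (-N)) * (∏ l, (leeMult q l : ℝ) ^ leeCount x l)
        * (∏ l, ((leeCount x l).factorial : ℝ))⁻¹ * (3 * (N + 1)) ^ (q / 2 + 1) := by
        rw [hprod]; ring
    _ ≤ (N.factorial : ℝ) * (∏ l, (leeMult q l : ℝ) ^ leeCount x l)
        * (∏ l, ((leeCount x l).factorial : ℝ))⁻¹ * (3 * (N + 1)) ^ (q / 2 + 1) := by gcongr
    _ ≤ ((typeClass ι (leeType x)).ncard * ∏ l, ((leeCount x l).factorial : ℝ))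
        * (∏ l, ((leeCount x l).factorial : ℝ))⁻¹ * (3 * (N + 1)) ^ (q / 2 + 1) := by gcongr
    _ = _ := by field_simp

theorem leeType_concat [NeZero q] [Nonempty κ] {θ : TypeVec q} (e : ι' ≃ κ × ι)
    (x : κ → ι → ZMod q) (h : ∀ k, leeType (x k) = θ) :
    leeType (fun i => x (e i).1 (e i).2) = θ := by
  rw [← leeType_prod x h, ← leeType_comp_equiv e]

/-- Up to a polynomial factor in the block length, the type class of `k` blocks is no larger than
the `k`-th power of the type class of one block. -/
theorem ncard_typeClass_concat_le [NeZero q] [Nonempty ι] [Nonempty κ] (e : ι' ≃ κ × ι)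
    (x : ι → ZMod q) :
    ((typeClass ι' (leeType x)).ncard : ℝ)
      ≤ ((3 * (Fintype.card ι + 1)) ^ (q / 2 + 1) * ((typeClass ι (leeType x)).ncard : ℝ))
        ^ Fintype.card κ := by
  have : Nonempty ι' := e.nonempty
  refine (ncard_typeClass_le _).trans ?_
  refine le_trans (le_of_eq ?_) (pow_le_pow_left₀ (by positivity) (two_rpow_classRate_le x) _)
  rw [Fintype.card_congr e, Fintype.card_prod, ← Real.rpow_natCast, ← Real.rpow_mul (by norm_num)]
  push_cast
  ring_nf

end TypeClass

/-! ### The law of the edge vector -/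

section Law

variable {q dv dc n : ℕ}

theorem ncard_preimage_eq_mul {α β : Type*} [Finite α] [Finite β] (f : α → β) (K : Set α)
    (S : Set β) (R : ℕ) (h : ∀ b ∈ S, {a | a ∈ K ∧ f a = b}.ncard = R) :
    {a | a ∈ K ∧ f a ∈ S}.ncard = S.ncard * R := by
  classical
  have := Fintype.ofFinite α
  have := Fintype.ofFinite β
  have key : ∀ b ∈ S, {a | a ∈ K ∧ f a = b}.ncard
      = ((Finset.univ.filter fun a => a ∈ K ∧ f a ∈ S).filter fun a => f a = b).card := by
    intro b hb
    rw [← Set.ncard_coe_finset]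
    congr 1
    ext a
    simp only [Finset.coe_filter, Finset.mem_filter, Finset.mem_univ, true_and,
      Set.mem_ofPred_eq]
    constructor
    · rintro ⟨h1, rfl⟩; exact ⟨⟨h1, hb⟩, rfl⟩
    · rintro ⟨⟨h1, _⟩, h2⟩; exact ⟨h1, h2⟩
  have h1 : {a | a ∈ K ∧ f a ∈ S}.ncard = (Finset.univ.filter fun a => a ∈ K ∧ f a ∈ S).card := by
    rw [← Set.ncard_coe_finset]; simp
  have h2 : S.ncard = (Finset.univ.filter fun b => b ∈ S).card := by
    rw [← Set.ncard_coe_finset]; simp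
  rw [h1, h2, Finset.card_eq_sum_card_fiberwise (f := f) (t := Finset.univ.filter fun b => b ∈ S)
    (by intro a ha; simpa using (by simpa using ha : a ∈ K ∧ f a ∈ S).2),
    ← smul_eq_mul, ← Finset.sum_const]
  refine Finset.sum_congr rfl fun b hb => ?_
  have hb' : b ∈ S := by simpa using hb
  rw [← key b hb', h b hb']

/-- Permuting the check sockets and changing the labels shows that vectors of the same type are
equally likely to be the edge vector, for any set of inputs. -/
theorem ncard_edgeVector_eq_le [NeZero q] (K : Set (Fin n → ZMod q))
    {z z' : Fin (n * dv / dc) × Fin dc → ZMod q} (h : leeType z = leeType z') :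
    {p : Experiment q dv dc n | p.1 ∈ K ∧ edgeVector p.1 p.2 = z}.ncard
      ≤ {p : Experiment q dv dc n | p.1 ∈ K ∧ edgeVector p.1 p.2 = z'}.ncard := by
  obtain ⟨σ, u, -, hu⟩ := exists_perm_of_leeType_eq h
  refine Set.ncard_le_ncard_of_injOn
    (fun p => (p.1, (fun s => u (σ.symm (p.2.2 s)) * p.2.1 s, p.2.2.trans σ.symm))) ?_ ?_
  · rintro ⟨c, l, π⟩ ⟨hc, rfl⟩
    refine ⟨hc, funext fun e => ?_⟩
    rw [hu]
    simp [edgeVector, mul_assoc]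
  · rintro ⟨c, l, π⟩ - ⟨c', l', π'⟩ - hp
    simp only [Prod.mk.injEq] at hp
    obtain ⟨rfl, h1, h2⟩ := hp
    have hπ : π = π' := by
      ext1 s
      simpa using congrArg (fun e => σ (e s)) h2
    subst hπ
    simp only [Prod.mk.injEq, true_and, and_true]
    funext s
    simpa using congrFun h1 s

/-- Given its type, the edge vector is uniform on the type class, independently of the type of the
input. -/
theorem ncard_edgeVector_mul [NeZero q] (K : Set (Fin n → ZMod q))
    (S : Set (Fin (n * dv / dc) × Fin dc → ZMod q)) (ω : TypeVec q) :
    {p : Experiment q dv dc n | p.1 ∈ K ∧ edgeVector p.1 p.2 ∈ S ∩ typeClass _ ω}.ncard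
        * (typeClass (Fin (n * dv / dc) × Fin dc) ω).ncard
      = (S ∩ typeClass _ ω).ncard
        * {p : Experiment q dv dc n | p.1 ∈ K ∧ edgeVector p.1 p.2 ∈ typeClass _ ω}.ncard := by
  rcases (typeClass (Fin (n * dv / dc) × Fin dc) ω).eq_empty_or_nonempty with h | ⟨z, hz⟩
  · simp [h]
  have hR : ∀ b ∈ typeClass (Fin (n * dv / dc) × Fin dc) ω,
      {p : Experiment q dv dc n | p ∈ {p : Experiment q dv dc n | p.1 ∈ K}
        ∧ edgeVector p.1 p.2 = b}.ncard
      = {p : Experiment q dv dc n | p.1 ∈ K ∧ edgeVector p.1 p.2 = z}.ncard := fun b hb =>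
    le_antisymm (ncard_edgeVector_eq_le K (Eq.trans hb (Eq.symm hz)))
      (ncard_edgeVector_eq_le K (Eq.trans hz (Eq.symm hb)))
  have h1 := ncard_preimage_eq_mul (fun p : Experiment q dv dc n => edgeVector p.1 p.2)
    {p | p.1 ∈ K} _ _ hR
  have h2 := ncard_preimage_eq_mul (fun p : Experiment q dv dc n => edgeVector p.1 p.2)
    {p | p.1 ∈ K} (S ∩ typeClass _ ω) _ fun b hb => hR b hb.2
  simp only [Set.mem_ofPred_eq] at h1 h2
  rw [h1, h2]
  ring

/-- The hypothesis guarantees that `ω` occurs as the type of an edge vector; otherwise `checkProb`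
is zero, while the type class may contain vectors that satisfy the checks. -/
theorem checkProb_eq [NeZero q] {ω : TypeVec q} (h : (outputType dv dc n ω).Nonempty) :
    checkProb dv dc n ω
      = (({z | SatisfiesChecks z} ∩ typeClass (Fin (n * dv / dc) × Fin dc) ω).ncard : ℝ)
        / (typeClass (Fin (n * dv / dc) × Fin dc) ω).ncard := by
  have hB := ncard_edgeVector_mul (dv := dv) (dc := dc) (n := n) Set.univ
    {z | SatisfiesChecks z} ω
  have hO : {p : Experiment q dv dc n | p.1 ∈ Set.univ ∧ edgeVector p.1 p.2 ∈ typeClass _ ω}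
      = outputType dv dc n ω := by ext p; simp [outputType, typeClass]
  have hX : {p : Experiment q dv dc n | p.1 ∈ Set.univ ∧
        edgeVector p.1 p.2 ∈ {z | SatisfiesChecks z} ∩ typeClass _ ω}
      = checksHold q dv dc n ∩ outputType dv dc n ω := by
    ext p; simp [outputType, typeClass, checksHold]
  rw [hO, hX] at hB
  have hOpos : 0 < (outputType dv dc n ω).ncard := (Set.ncard_pos).2 h
  have hTpos : 0 < (typeClass (Fin (n * dv / dc) × Fin dc) ω).ncard := by
    obtain ⟨p, hp⟩ := h
    exact (Set.ncard_pos).2 ⟨_, hp⟩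
  rw [checkProb, condProb, div_eq_div_iff (by exact_mod_cast hOpos.ne')
    (by exact_mod_cast hTpos.ne')]
  exact_mod_cast hB

/-- The type of the input, the type of the edge vector and the check equations form a Markov
chain. -/
theorem condProb_inter_outputType [NeZero q] (ω θ : TypeVec q) :
    condProb (checksHold q dv dc n ∩ outputType dv dc n ω) (inputType dv dc n θ)
      = typeTransition dv dc n ω θ * checkProb dv dc n ω := by
  rcases (outputType dv dc n ω ∩ inputType dv dc n θ).eq_empty_or_nonempty with h | ⟨p, hp⟩
  · rw [typeTransition, condProb, condProb, Set.inter_assoc, h]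
    simp
  have hB := ncard_edgeVector_mul (dv := dv) (dc := dc) (n := n) (typeClass (Fin n) θ)
    {z | SatisfiesChecks z} ω
  have hO : {p : Experiment q dv dc n | p.1 ∈ typeClass (Fin n) θ
        ∧ edgeVector p.1 p.2 ∈ typeClass _ ω}
      = outputType dv dc n ω ∩ inputType dv dc n θ := by
    ext p; simp [outputType, typeClass, inputType, and_comm]
  have hX : {p : Experiment q dv dc n | p.1 ∈ typeClass (Fin n) θ ∧
        edgeVector p.1 p.2 ∈ {z | SatisfiesChecks z} ∩ typeClass _ ω}
      = checksHold q dv dc n ∩ outputType dv dc n ω ∩ inputType dv dc n θ := by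
    ext p; simp only [Set.mem_inter_iff, outputType, typeClass, checksHold, inputType,
      Set.mem_ofPred_eq]; tauto
  rw [hO, hX] at hB
  have hTpos : (0 : ℝ) < (typeClass (Fin (n * dv / dc) × Fin dc) ω).ncard := by
    have hne : (typeClass (Fin (n * dv / dc) × Fin dc) ω).Nonempty := ⟨_, hp.1⟩
    exact_mod_cast (Set.ncard_pos).2 hne
  have hIpos : (0 : ℝ) < (inputType dv dc n θ).ncard := by
    exact_mod_cast (Set.ncard_pos).2 ⟨_, hp.2⟩
  have hB' := congrArg (Nat.cast : ℕ → ℝ) hB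
  push_cast at hB'
  rw [checkProb_eq ⟨p, hp.1⟩, typeTransition, condProb, condProb]
  field_simp
  linarith

theorem condProb_checksHold_eq_sum [NeZero q] (θ : TypeVec q) :
    condProb (checksHold q dv dc n) (inputType dv dc n θ)
      = ∑ ω ∈ typesOf q (Fin (n * dv / dc) × Fin dc),
        typeTransition dv dc n ω θ * checkProb dv dc n ω := by
  classical
  simp_rw [← condProb_inter_outputType, condProb]
  rw [← Finset.sum_div, ← Nat.cast_sum]
  congr 2
  have h1 : ∀ S : Set (Experiment q dv dc n), S.ncard = (Finset.univ.filter (· ∈ S)).card := by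
    intro S
    rw [← Set.ncard_coe_finset]; simp
  rw [h1, Finset.card_eq_sum_card_fiberwise
    (f := fun p : Experiment q dv dc n => leeType (edgeVector p.1 p.2))
    (t := typesOf q (Fin (n * dv / dc) × Fin dc)) (fun p _ => leeType_mem_typesOf _)]
  refine Finset.sum_congr rfl fun ω _ => ?_
  rw [h1]
  congr 1
  ext p
  simp only [Finset.mem_filter, Finset.mem_univ, true_and, Set.mem_inter_iff, outputType,
    Set.mem_ofPred_eq]
  tauto

theorem leeType_edgeVector [NeZero q] (c : Fin n → ZMod q) (x : Ensemble q dv dc n) :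
    leeType (edgeVector c x) = leeType fun s : Fin n × Fin dv => (x.1 s : ZMod q) * c s.1 := by
  rw [← leeType_comp_equiv x.2.symm fun s : Fin n × Fin dv => (x.1 s : ZMod q) * c s.1]
  rfl

/-- The edge labelings that turn `c` into a vector of type `ω`. -/
def goodLabels (dv : ℕ) (c : Fin n → ZMod q) (ω : TypeVec q) :
    Set (Fin n × Fin dv → (ZMod q)ˣ) :=
  {l | leeType (fun s : Fin n × Fin dv => (l s : ZMod q) * c s.1) = ω}

/-- The units relating two inputs of the same type do not change Lee weights, so permuting the
labels along with the positions matches their good labelings. -/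
theorem ncard_goodLabels_le [NeZero q] {c c' : Fin n → ZMod q} (h : leeType c = leeType c')
    (ω : TypeVec q) : (goodLabels dv c ω).ncard ≤ (goodLabels dv c' ω).ncard := by
  obtain ⟨σ, u, hu, hc⟩ := exists_perm_of_leeType_eq h
  let e : Fin n × Fin dv ≃ Fin n × Fin dv := σ.prodCongr (Equiv.refl _)
  refine Set.ncard_le_ncard_of_injOn (fun l s => l (e s)) ?_ ?_
  · intro l hl
    change leeType _ = ω
    rw [← (hl : leeType _ = ω), ← leeType_comp_equiv e
      fun s : Fin n × Fin dv => (l s : ZMod q) * c s.1, leeType_eq_iff]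
    intro t
    simp only [leeCount]
    congr 2
    funext s
    rw [hc, mul_left_comm, hu]
    rfl
  · intro l _ l' _ hll
    funext s
    simpa using congrFun hll (e.symm s)

theorem ncard_inputType [NeZero q] (θ : TypeVec q) :
    (inputType dv dc n θ).ncard
      = (typeClass (Fin n) θ).ncard * Nat.card (Ensemble q dv dc n) := by
  have : inputType dv dc n θ = typeClass (Fin n) θ ×ˢ Set.univ := by
    ext p; simp [inputType, typeClass]
  rw [this, Set.ncard_prod, Set.ncard_univ]

/-- The number of good labelings depends on the input only through its type, and the bijection of
the sockets does not affect the type of the edge vector. -/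
theorem typeTransition_eq [NeZero q] (hE : Nonempty (Ensemble q dv dc n)) {θ : TypeVec q}
    {c : Fin n → ZMod q} (hc : leeType c = θ) (ω : TypeVec q) :
    typeTransition dv dc n ω θ = ((goodLabels dv c ω).ncard : ℝ)
      / Nat.card (Fin n × Fin dv → (ZMod q)ˣ) := by
  set Q := Nat.card (Fin n × Fin dv ≃ Fin (n * dv / dc) × Fin dc) with hQ
  have hfib : ∀ b ∈ typeClass (Fin n) θ,
      {p : Experiment q dv dc n | p ∈ outputType dv dc n ω ∧ p.1 = b}.ncard
        = (goodLabels dv c ω).ncard * Q := by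
    intro b hb
    have hset : {p : Experiment q dv dc n | p ∈ outputType dv dc n ω ∧ p.1 = b}
        = {b} ×ˢ (goodLabels dv b ω ×ˢ Set.univ) := by
      ext ⟨c', x⟩
      simp only [outputType, Set.mem_ofPred_eq, Set.mem_prod, Set.mem_singleton_iff, Set.mem_univ,
        and_true, goodLabels, leeType_edgeVector]
      constructor
      · rintro ⟨h, rfl⟩; exact ⟨rfl, h⟩
      · rintro ⟨rfl, h⟩; exact ⟨h, rfl⟩
    rw [hset, Set.ncard_prod, Set.ncard_prod, Set.ncard_singleton, one_mul, Set.ncard_univ]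
    have hbc : leeType b = leeType c := Eq.trans hb hc.symm
    rw [le_antisymm (ncard_goodLabels_le hbc ω) (ncard_goodLabels_le hbc.symm ω)]
  have h1 : (outputType dv dc n ω ∩ inputType dv dc n θ).ncard
      = (typeClass (Fin n) θ).ncard * ((goodLabels dv c ω).ncard * Q) :=
    ncard_preimage_eq_mul Prod.fst (outputType dv dc n ω) (typeClass (Fin n) θ) _ hfib
  have hTpos : 0 < (typeClass (Fin n) θ).ncard := (Set.ncard_pos).2 ⟨c, hc⟩
  have hQpos : 0 < Q := by
    have : Nonempty (Fin n × Fin dv ≃ Fin (n * dv / dc) × Fin dc) := ⟨hE.some.2⟩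
    exact Nat.card_pos
  have hE' : Nat.card (Ensemble q dv dc n) = Nat.card (Fin n × Fin dv → (ZMod q)ˣ) * Q :=
    Nat.card_prod _ _
  have hLpos : 0 < Nat.card (Fin n × Fin dv → (ZMod q)ˣ) := Nat.card_pos
  rw [typeTransition, condProb, h1, ncard_inputType, hE']
  push_cast
  have h2 : ((typeClass (Fin n) θ).ncard : ℝ) ≠ 0 := by exact_mod_cast hTpos.ne'
  have h3 : (Q : ℝ) ≠ 0 := by exact_mod_cast hQpos.ne'
  have h4 : (Nat.card (Fin n × Fin dv → (ZMod q)ˣ) : ℝ) ≠ 0 := by exact_mod_cast hLpos.ne'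
  rw [← mul_assoc, ← mul_assoc, mul_div_mul_right _ _ h3, mul_div_mul_left _ _ h2]

/-- Repeating every entry `dv` times preserves Lee types, and multiplication by units preserves
orbits. -/
theorem orbitFrac_edgeVector [NeZero q] (hdv : 1 ≤ dv) (c : Fin n → ZMod q)
    (x : Ensemble q dv dc n) (d : ℕ) :
    orbitFrac (leeType (edgeVector c x)) d = orbitFrac (leeType c) d := by
  classical
  have : Nonempty (Fin dv) := ⟨⟨0, hdv⟩⟩
  have h1 : leeType c = leeType fun s : Fin n × Fin dv => c s.1 := by
    have h := leeType_prod (κ := Fin dv) (fun _ => c) fun _ => rfl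
    rw [← h, ← leeType_comp_equiv (Equiv.prodComm (Fin n) (Fin dv))]
    rfl
  rw [leeType_edgeVector, h1, orbitFrac_leeType, orbitFrac_leeType]
  congr 3
  ext s
  simp only [Finset.mem_filter, Finset.mem_univ, true_and]
  rw [← smul_eq_mul, ← Units.smul_def, ← MulAction.orbit_eq_iff, MulAction.orbit_smul,
    MulAction.orbit_eq_iff]

theorem leeType_edgeVector_mem [NeZero q] (hn : 1 ≤ n) (hdv : 1 ≤ dv) (c : Fin n → ZMod q)
    (x : Ensemble q dv dc n) : leeType (edgeVector c x) ∈ allEdgeTypes dv (leeType c) := by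
  refine ⟨n, hn, ⟨fun i => edgeVector c x (x.2 (finProdFinEquiv.symm i)), ?_⟩,
    fun d _ => orbitFrac_edgeVector hdv c x d⟩
  exact leeType_comp_equiv (finProdFinEquiv.symm.trans x.2) (edgeVector c x)

end Law

/-! ### Concatenation of blocks -/

section Concat

variable {q dv dc n k : ℕ}

theorem condProb_nonneg {Ω : Type*} (E F : Set Ω) : 0 ≤ condProb E F := by
  unfold condProb; positivity

theorem nonempty_of_condProb_ne_zero {Ω : Type*} {E F : Set Ω} (h : condProb E F ≠ 0) :
    (E ∩ F).Nonempty := by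
  rw [Set.nonempty_iff_ne_empty]
  intro h0
  simp [condProb, h0] at h

theorem card_sockets (x : Ensemble q dv dc n) : n * dv / dc * dc = n * dv := by
  simpa using (Fintype.card_congr x.2).symm

/-- Once the ensemble exists at length `n`, the divisions are exact. -/
theorem checks_concat (hdc : 1 ≤ dc) (x : Ensemble q dv dc n) (k : ℕ) :
    k * n * dv / dc = k * (n * dv / dc) := by
  have h := card_sockets x
  rw [mul_assoc, ← h, Nat.mul_div_cancel _ hdc, ← mul_assoc, Nat.mul_div_cancel _ hdc]

theorem nonempty_ensemble_concat (hdc : 1 ≤ dc) (x : Ensemble q dv dc n) (k : ℕ) :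
    Nonempty (Ensemble q dv dc (k * n)) := by
  refine ⟨fun _ => 1, Fintype.equivOfCardEq ?_⟩
  have h := card_sockets x
  simp only [Fintype.card_prod, Fintype.card_fin]
  rw [checks_concat hdc x k, mul_assoc, mul_assoc, h]

/-- The type transition probability is supermultiplicative along multiples of a length: the labels
of `k` copies of a vector may be chosen blockwise. -/
theorem typeTransition_pow_le [NeZero q] (hdc : 1 ≤ dc) (hk : 1 ≤ k) (ω θ : TypeVec q) :
    typeTransition dv dc n ω θ ^ k ≤ typeTransition dv dc (k * n) ω θ := by
  by_cases h0 : typeTransition dv dc n ω θ = 0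
  · rw [h0, zero_pow (by omega)]
    exact condProb_nonneg _ _
  obtain ⟨⟨c, x⟩, -, hc⟩ := nonempty_of_condProb_ne_zero h0
  replace hc : leeType c = θ := hc
  have : Nonempty (Fin k) := ⟨⟨0, hk⟩⟩
  let e : Fin (k * n) ≃ Fin k × Fin n := finProdFinEquiv.symm
  let c' : Fin (k * n) → ZMod q := fun i => c (e i).2
  have hc' : leeType c' = θ := leeType_concat e (fun _ => c) fun _ => hc
  let e2 : Fin (k * n) × Fin dv ≃ Fin k × (Fin n × Fin dv) :=
    (e.prodCongr (Equiv.refl _)).trans (Equiv.prodAssoc _ _ _)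
  have hpow := ncard_pow_le_ncard (goodLabels dv c ω) (goodLabels dv c' ω) e2 fun l hl =>
    leeType_concat e2 (fun j s => (l j s : ZMod q) * c s.1) hl
  rw [Fintype.card_fin] at hpow
  rw [typeTransition_eq ⟨x⟩ hc, typeTransition_eq (nonempty_ensemble_concat hdc x k) hc', div_pow]
  have hcard : (Nat.card (Fin n × Fin dv → (ZMod q)ˣ) : ℝ) ^ k
      = Nat.card (Fin (k * n) × Fin dv → (ZMod q)ˣ) := by
    simp only [Nat.card_fun, Nat.card_prod, Nat.card_fin]
    push_cast
    rw [← pow_mul]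
    ring_nf
  rw [hcard]
  gcongr
  exact_mod_cast hpow

/-- Up to a polynomial factor per block, the probability that the checks are satisfied is
supermultiplicative along multiples of a length. -/
theorem checkProb_pow_le [NeZero q] (hdv : 1 ≤ dv) (hdc : 1 ≤ dc) (hn : 1 ≤ n) (hk : 1 ≤ k)
    {ω : TypeVec q} (h : (outputType dv dc n ω).Nonempty)
    (h' : (outputType dv dc (k * n) ω).Nonempty) :
    (checkProb dv dc n ω / (3 * ((n * dv : ℕ) + 1)) ^ (q / 2 + 1)) ^ k
      ≤ checkProb dv dc (k * n) ω := by
  rw [checkProb_eq h, checkProb_eq h']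
  obtain ⟨⟨c, x⟩, hx⟩ := h
  replace hx : leeType (edgeVector c x) = ω := hx
  obtain ⟨⟨c', x'⟩, hx'⟩ := h'
  have : Nonempty (Fin k) := ⟨⟨0, hk⟩⟩
  have : Nonempty (Fin (n * dv / dc) × Fin dc) := ⟨x.2 (⟨0, hn⟩, ⟨0, hdv⟩)⟩
  let e : Fin (k * n * dv / dc) ≃ Fin k × Fin (n * dv / dc) :=
    (finCongr (checks_concat hdc x k)).trans finProdFinEquiv.symm
  let e2 : Fin (k * n * dv / dc) × Fin dc ≃ Fin k × (Fin (n * dv / dc) × Fin dc) :=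
    (e.prodCongr (Equiv.refl _)).trans (Equiv.prodAssoc _ _ _)
  have hpow := ncard_pow_le_ncard ({z | SatisfiesChecks z} ∩ typeClass _ ω)
    ({z | SatisfiesChecks z} ∩ typeClass _ ω) e2 fun z hz =>
      ⟨fun j => (hz (e j).1).1 (e j).2, leeType_concat e2 z fun i => (hz i).2⟩
  have hT := ncard_typeClass_concat_le e2 (edgeVector c x)
  rw [hx, Fintype.card_prod, Fintype.card_fin, Fintype.card_fin, card_sockets x] at hT
  rw [Fintype.card_fin] at hT hpow
  have hne : (typeClass (Fin (k * n * dv / dc) × Fin dc) ω).Nonempty := ⟨_, hx'⟩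
  have hpos : (0 : ℝ) < (typeClass (Fin (k * n * dv / dc) × Fin dc) ω).ncard := by
    exact_mod_cast (Set.ncard_pos).2 hne
  have hpow' : (((({z | SatisfiesChecks z} ∩ typeClass (Fin (n * dv / dc) × Fin dc) ω).ncard) ^ k
      : ℕ) : ℝ) ≤ (({z | SatisfiesChecks z} ∩
        typeClass (Fin (k * n * dv / dc) × Fin dc) ω).ncard : ℝ) := Nat.cast_le.2 hpow
  rw [Nat.cast_pow] at hpow'
  rw [div_div, mul_comm ((typeClass _ ω).ncard : ℝ), div_pow]
  exact div_le_div₀ (Nat.cast_nonneg _) hpow' hpos hT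

theorem ncard_typeClass_pow_le [NeZero q] (hk : 1 ≤ k) (θ : TypeVec q) :
    (typeClass (Fin n) θ).ncard ^ k ≤ (typeClass (Fin (k * n)) θ).ncard := by
  have : Nonempty (Fin k) := ⟨⟨0, hk⟩⟩
  have h := ncard_pow_le_ncard (typeClass (Fin n) θ) (typeClass (Fin (k * n)) θ)
    finProdFinEquiv.symm fun x hx => leeType_concat finProdFinEquiv.symm x hx
  rwa [Fintype.card_fin] at h

/-- Some edge type carries all but a polynomial factor of the probability that the checks are
satisfied. -/
theorem exists_dominant_edgeType [NeZero q] (hdv : 1 ≤ dv) (hn : 1 ≤ n) {θ : TypeVec q}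
    (h : condProb (checksHold q dv dc n) (inputType dv dc n θ) ≠ 0) :
    ∃ ω ∈ allEdgeTypes dv θ, 0 < typeTransition dv dc n ω θ ∧ 0 < checkProb dv dc n ω ∧
      condProb (checksHold q dv dc n) (inputType dv dc n θ)
        ≤ (3 * ((n * dv : ℕ) + 1)) ^ (q / 2 + 1)
          * (typeTransition dv dc n ω θ * checkProb dv dc n ω) := by
  obtain ⟨⟨c₀, x₀⟩, -⟩ := nonempty_of_condProb_ne_zero h
  have hnonneg : ∀ ω, 0 ≤ typeTransition dv dc n ω θ * checkProb dv dc n ω := fun ω =>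
    mul_nonneg (condProb_nonneg _ _) (condProb_nonneg _ _)
  have hne : (typesOf q (Fin (n * dv / dc) × Fin dc)).Nonempty := ⟨_, leeType_mem_typesOf 0⟩
  obtain ⟨ω, -, hmax⟩ := Finset.exists_max_image _
    (fun ω => typeTransition dv dc n ω θ * checkProb dv dc n ω) hne
  have hle : condProb (checksHold q dv dc n) (inputType dv dc n θ)
      ≤ (3 * ((n * dv : ℕ) + 1)) ^ (q / 2 + 1)
        * (typeTransition dv dc n ω θ * checkProb dv dc n ω) := by
    rw [condProb_checksHold_eq_sum]
    refine (Finset.sum_le_card_nsmul _ _ _ hmax).trans ?_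
    rw [nsmul_eq_mul]
    refine mul_le_mul_of_nonneg_right ?_ (hnonneg ω)
    have hc := card_typesOf_le (q := q) (ι := Fin (n * dv / dc) × Fin dc)
    rw [Fintype.card_prod, Fintype.card_fin, Fintype.card_fin, card_sockets x₀] at hc
    refine le_trans (by exact_mod_cast hc :
      _ ≤ (((n * dv : ℕ) : ℝ) + 1) ^ (q / 2 + 1)) (pow_le_pow_left₀ (by positivity) ?_ _)
    have : (0 : ℝ) ≤ ((n * dv : ℕ) : ℝ) := Nat.cast_nonneg _
    linarith
  have hpos : 0 < condProb (checksHold q dv dc n) (inputType dv dc n θ) :=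
    lt_of_le_of_ne (condProb_nonneg _ _) h.symm
  have hfa : 0 < typeTransition dv dc n ω θ * checkProb dv dc n ω := by
    refine lt_of_le_of_ne (hnonneg ω) fun h0 => ?_
    rw [← h0, mul_zero] at hle
    exact hle.not_gt hpos
  have hf : 0 < typeTransition dv dc n ω θ :=
    pos_of_mul_pos_left hfa (condProb_nonneg _ _)
  have ha : 0 < checkProb dv dc n ω := pos_of_mul_pos_right hfa (condProb_nonneg _ _)
  refine ⟨ω, ?_, hf, ha, hle⟩
  obtain ⟨⟨c, x⟩, rfl, rfl⟩ := nonempty_of_condProb_ne_zero hf.ne'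
  exact leeType_edgeVector_mem hn hdv c x

theorem typeTransition_mul_checkProb_le [NeZero q] (ω θ : TypeVec q) :
    typeTransition dv dc n ω θ * checkProb dv dc n ω
      ≤ condProb (checksHold q dv dc n) (inputType dv dc n θ) := by
  rw [← condProb_inter_outputType, condProb, condProb]
  gcongr
  · exact Set.toFinite _
  · exact Set.inter_subset_left

/-! ### Average enumerators -/

/-- Double counting of the pairs of a codeword of type `θ` and an element of the ensemble. -/
theorem avgTypeEnum_eq [NeZero q] (θ : TypeVec q) :
    avgTypeEnum dv dc n θ = (typeClass (Fin n) θ).ncard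
      * condProb (checksHold q dv dc n) (inputType dv dc n θ) := by
  classical
  have hsum : ∑ x : Ensemble q dv dc n, typeEnum x θ
      = (checksHold q dv dc n ∩ inputType dv dc n θ).ncard := by
    have h1 : (checksHold q dv dc n ∩ inputType dv dc n θ).ncard
        = (Finset.univ.filter (· ∈ checksHold q dv dc n ∩ inputType dv dc n θ)).card := by
      rw [← Set.ncard_coe_finset]; simp
    rw [h1, Finset.card_eq_sum_card_fiberwise (f := Prod.snd) (t := Finset.univ) (by simp)]
    refine Finset.sum_congr rfl fun x _ => ?_
    rw [typeEnum, ← Set.ncard_coe_finset]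
    refine Set.ncard_congr (fun c _ => (c, x)) ?_ ?_ ?_
    · rintro c ⟨hc, hθ⟩
      simpa [checksHold, inputType, hθ] using (mem_code_iff x c).1 hc
    · intro c c' _ _ h
      exact congrArg Prod.fst h
    · rintro ⟨c, y⟩ hy
      simp only [Finset.coe_filter, Finset.mem_filter, Finset.mem_univ, true_and,
        Set.mem_ofPred_eq] at hy
      obtain ⟨⟨h2, h3⟩, rfl⟩ := hy
      exact ⟨c, ⟨(mem_code_iff y c).2 h2, h3⟩, rfl⟩
  rw [avgTypeEnum, ensembleAvg, ← Nat.cast_sum, hsum, condProb, ncard_inputType,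
    Nat.card_eq_fintype_card]
  rcases (typeClass (Fin n) θ).eq_empty_or_nonempty with h | h
  · have : inputType dv dc n θ = ∅ := by
      ext p
      simp only [inputType, Set.mem_ofPred_eq, Set.mem_empty_iff_false, iff_false]
      intro hp
      exact (h ▸ (show p.1 ∈ typeClass (Fin n) θ from hp) : p.1 ∈ (∅ : Set _))
    simp [this]
  · have : ((typeClass (Fin n) θ).ncard : ℝ) ≠ 0 := by
      exact_mod_cast ((Set.ncard_pos).2 h).ne'
    push_cast
    rw [← mul_div_assoc, mul_div_mul_left _ _ this]

theorem avgWeightEnum_eq_sum [NeZero q] (w : ℝ) :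
    avgWeightEnum q dv dc n w
      = ∑ θ ∈ (typesOf q (Fin n)).filter (fun θ => n * typeWeight θ = w),
        avgTypeEnum dv dc n θ := by
  classical
  simp only [avgWeightEnum, avgTypeEnum, ensembleAvg]
  rw [← Finset.sum_div, Finset.sum_comm]
  congr 1
  refine Finset.sum_congr rfl fun x _ => ?_
  rw [← Nat.cast_sum]
  congr 1
  have h1 : weightEnum x w
      = (Finset.univ.filter fun c => c ∈ code x ∧ (vecLeeWeight c : ℝ) = w).card := by
    rw [weightEnum, ← Set.ncard_coe_finset]; simp
  rw [h1, Finset.card_eq_sum_card_fiberwise (f := fun c : Fin n → ZMod q => leeType c)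
    (t := (typesOf q (Fin n)).filter fun θ => n * typeWeight θ = w)]
  · refine Finset.sum_congr rfl fun θ hθ => ?_
    rw [typeEnum, ← Set.ncard_coe_finset]
    congr 1
    ext c
    simp only [Finset.coe_filter, Finset.mem_filter, Finset.mem_univ, true_and, Set.mem_ofPred_eq]
    constructor
    · rintro ⟨⟨h2, -⟩, h3⟩; exact ⟨h2, h3⟩
    · rintro ⟨h2, rfl⟩
      refine ⟨⟨h2, ?_⟩, rfl⟩
      rw [vecLeeWeight_eq, Fintype.card_fin]
      exact (Finset.mem_filter.1 hθ).2
  · intro c hc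
    have hc' : (vecLeeWeight c : ℝ) = w := by
      simpa using (Finset.mem_filter.1 (Finset.mem_coe.1 hc)).2.2
    rw [vecLeeWeight_eq, Fintype.card_fin] at hc'
    exact Finset.mem_coe.2 (Finset.mem_filter.2 ⟨leeType_mem_typesOf c, hc'⟩)

theorem avgTypeEnum_nonneg [NeZero q] (θ : TypeVec q) : 0 ≤ avgTypeEnum dv dc n θ := by
  rw [avgTypeEnum_eq]
  exact mul_nonneg (Nat.cast_nonneg _) (condProb_nonneg _ _)

end Concat

/-! ### Growth rates -/

section Growth

/-- A lower bound on a growth rate from the multiples of a single length. -/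
theorem le_growthRate {f : ℕ → ℝ} {n : ℕ} (hn : 1 ≤ n) {v : ℝ} (hv : 0 < v)
    (h : ∀ k, 1 ≤ k → v ^ k ≤ f (k * n)) :
    ((Real.logb 2 v / n : ℝ) : EReal) ≤ growthRate f := by
  refine le_limsup_of_frequently_le' (frequently_atTop.2 fun a => ⟨(a + 1) * n, ?_, ?_⟩)
  · nlinarith
  · have hk := h (a + 1) (by omega)
    have hpos : 0 < v ^ (a + 1) := pow_pos hv _
    rw [if_neg (hpos.trans_le hk).ne', EReal.coe_le_coe_iff]
    have hlog := Real.logb_le_logb_of_le (b := 2) (by norm_num) hpos hk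
    rw [Real.logb_pow] at hlog
    have hn' : (0 : ℝ) < n := by exact_mod_cast hn
    have ha : (0 : ℝ) < a + 1 := by positivity
    push_cast at hlog ⊢
    rw [div_le_div_iff₀ hn' (by positivity)]
    nlinarith [mul_le_mul_of_nonneg_right hlog hn'.le]

/-- An upper bound on a growth rate from bounds at every length, up to a vanishing error. -/
theorem growthRate_le {F w : ℕ → ℝ} {s : EReal} (hw : Tendsto w atTop (nhds 0))
    (h : ∀ n, 1 ≤ n → F n ≠ 0 → ∃ r : ℝ, (r : EReal) ≤ s ∧ Real.logb 2 (F n) / n ≤ r + w n) :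
    growthRate F ≤ s := by
  -- Addition on `EReal` is continuous at `(s, 0)` even for infinite `s`.
  have hlim : Tendsto (fun n => s + (w n : EReal)) atTop (nhds (s + ((0 : ℝ) : EReal))) := by
    have hc : ContinuousAt (fun p : EReal × EReal => p.1 + p.2) (s, ((0 : ℝ) : EReal)) :=
      EReal.continuousAt_add (Or.inr (EReal.coe_ne_bot _)) (Or.inr (EReal.coe_ne_top _))
    exact hc.tendsto.comp
      (tendsto_const_nhds.prodMk_nhds ((continuous_coe_real_ereal.tendsto 0).comp hw))
  rw [EReal.coe_zero, add_zero] at hlim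
  rw [← hlim.limsup_eq]
  refine limsup_le_limsup ?_
  filter_upwards [eventually_ge_atTop 1] with n hn
  split_ifs with h0
  · exact bot_le
  · obtain ⟨r, hr, hle⟩ := h n hn h0
    refine (EReal.coe_le_coe_iff.2 hle).trans ?_
    rw [EReal.coe_add]
    gcongr

theorem tendsto_logb_poly_div (D dv : ℕ) (hdv : 1 ≤ dv) :
    Tendsto (fun n : ℕ => (D : ℝ) * Real.logb 2 (3 * ((n * dv : ℕ) + 1)) / n) atTop (nhds 0) := by
  have hd : (0 : ℝ) < dv := by exact_mod_cast hdv
  have h1 := Real.tendsto_pow_log_div_mul_add_atTop (1 / (3 * dv)) (-1 / dv) 1 (by positivity)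
  have h2 : Tendsto (fun n : ℕ => (3 * (((n * dv : ℕ) : ℝ) + 1))) atTop atTop := by
    refine tendsto_atTop_mono (fun n => ?_) tendsto_natCast_atTop_atTop
    have : (n : ℝ) ≤ ((n * dv : ℕ) : ℝ) := by exact_mod_cast Nat.le_mul_of_pos_right n hdv
    have : (0 : ℝ) ≤ (n : ℝ) := Nat.cast_nonneg n
    linarith
  have h3 := (h1.comp h2).const_mul (D / Real.log 2)
  rw [mul_zero] at h3
  refine h3.congr fun n => ?_
  have h4 : 1 / (3 * (dv : ℝ)) * (3 * (((n * dv : ℕ) : ℝ) + 1)) + -1 / dv = n := by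
    push_cast; field_simp; ring
  simp only [Function.comp, pow_one, h4, Real.logb]
  ring

end Growth

/-! ### Bounds on the growth rates -/

section Bounds

variable {q dv dc n : ℕ}

theorem le_phi [NeZero q] (hdc : 1 ≤ dc) (hn : 1 ≤ n) {ω θ : TypeVec q}
    (hf : 0 < typeTransition dv dc n ω θ) :
    ((Real.logb 2 (typeTransition dv dc n ω θ) / n : ℝ) : EReal) ≤ phi dv dc ω θ :=
  le_growthRate hn hf fun _ hk => typeTransition_pow_le hdc hk ω θ

theorem outputType_concat_nonempty [NeZero q] (hdc : 1 ≤ dc) {k : ℕ} (hk : 1 ≤ k)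
    {ω θ : TypeVec q} (hf : 0 < typeTransition dv dc n ω θ) :
    (outputType dv dc (k * n) ω).Nonempty :=
  (nonempty_of_condProb_ne_zero
    ((pow_pos hf k).trans_le (typeTransition_pow_le hdc hk ω θ)).ne').mono Set.inter_subset_left

theorem checkProb_div_pow_le [NeZero q] (hdv : 1 ≤ dv) (hdc : 1 ≤ dc) (hn : 1 ≤ n) {k : ℕ}
    (hk : 1 ≤ k) {ω θ : TypeVec q} (hf : 0 < typeTransition dv dc n ω θ) :
    (checkProb dv dc n ω / (3 * ((n * dv : ℕ) + 1)) ^ (q / 2 + 1)) ^ k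
      ≤ checkProb dv dc (k * n) ω :=
  checkProb_pow_le hdv hdc hn hk
    ((nonempty_of_condProb_ne_zero hf.ne').mono Set.inter_subset_left)
    (outputType_concat_nonempty hdc hk hf)

theorem le_alpha [NeZero q] (hdv : 1 ≤ dv) (hdc : 1 ≤ dc) (hn : 1 ≤ n) {ω θ : TypeVec q}
    (hf : 0 < typeTransition dv dc n ω θ) (ha : 0 < checkProb dv dc n ω) :
    ((Real.logb 2 (checkProb dv dc n ω / (3 * ((n * dv : ℕ) + 1)) ^ (q / 2 + 1)) / n : ℝ) : EReal)
      ≤ alpha dv dc ω :=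
  le_growthRate hn (by positivity) fun _ hk => checkProb_div_pow_le hdv hdc hn hk hf

/-- At every length, the conditional probability that the checks are satisfied obeys the bound on
its growth rate up to a polynomial factor. -/
theorem exists_rate_checksHold [NeZero q] (hdv : 1 ≤ dv) (hdc : 1 ≤ dc) (hn : 1 ≤ n)
    {θ : TypeVec q} (h : condProb (checksHold q dv dc n) (inputType dv dc n θ) ≠ 0) :
    ∃ r : ℝ, (r : EReal) ≤ (⨆ ω ∈ allEdgeTypes dv θ, (phi dv dc ω θ + alpha dv dc ω)) ∧
      Real.logb 2 (condProb (checksHold q dv dc n) (inputType dv dc n θ)) / n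
        ≤ r + ((2 * (q / 2 + 1) : ℕ) : ℝ) * Real.logb 2 (3 * ((n * dv : ℕ) + 1)) / n := by
  obtain ⟨ω, hω, hf, ha, hle⟩ := exists_dominant_edgeType hdv hn h
  have hpos : 0 < condProb (checksHold q dv dc n) (inputType dv dc n θ) :=
    lt_of_le_of_ne (condProb_nonneg _ _) h.symm
  have hlog := Real.logb_le_logb_of_le (b := 2) (by norm_num) hpos hle
  refine ⟨Real.logb 2 (typeTransition dv dc n ω θ) / n
    + Real.logb 2 (checkProb dv dc n ω / (3 * ((n * dv : ℕ) + 1)) ^ (q / 2 + 1)) / n, ?_, ?_⟩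
  · refine le_trans ?_ (le_iSup₂ (f := fun ω _ => phi dv dc ω θ + alpha dv dc ω) ω hω)
    rw [EReal.coe_add]
    exact add_le_add (le_phi hdc hn hf) (le_alpha hdv hdc hn hf ha)
  · rw [Real.logb_mul (by positivity) (by positivity), Real.logb_mul hf.ne' ha.ne',
      Real.logb_pow] at hlog
    rw [Real.logb_div ha.ne' (by positivity), Real.logb_pow, ← add_div, ← add_div]
    gcongr
    refine hlog.trans (le_of_eq ?_)
    push_cast
    ring

/-- Whatever is at most exponentially larger than the conditional probability that the checks are
satisfied has at most the correspondingly larger growth rate. -/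
theorem growthRate_le_add_iSup [NeZero q] (hdv : 1 ≤ dv) (hdc : 1 ≤ dc) (θ : TypeVec q)
    {t : ℕ → ℝ} {h : ℝ} (ht0 : ∀ n, 0 ≤ t n)
    (ht : ∀ n, 1 ≤ n → (typeClass (Fin n) θ).Nonempty → t n ≤ 2 ^ (n * h)) :
    growthRate (fun n => t n * condProb (checksHold q dv dc n) (inputType dv dc n θ))
      ≤ (h : EReal) + ⨆ ω ∈ allEdgeTypes dv θ, (phi dv dc ω θ + alpha dv dc ω) := by
  refine growthRate_le (tendsto_logb_poly_div (2 * (q / 2 + 1)) dv hdv) fun n hn hF => ?_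
  have ht' : 0 < t n := lt_of_le_of_ne (ht0 n) (left_ne_zero_of_mul hF).symm
  have hP := right_ne_zero_of_mul hF
  obtain ⟨p, -, hp⟩ := nonempty_of_condProb_ne_zero hP
  obtain ⟨r, hr, hle⟩ := exists_rate_checksHold hdv hdc hn hP
  refine ⟨h + r, ?_, ?_⟩
  · rw [EReal.coe_add]
    gcongr
  · have hn' : (0 : ℝ) < n := by exact_mod_cast hn
    have hlog := Real.logb_le_logb_of_le (b := 2) (by norm_num) ht' (ht n hn ⟨p.1, hp⟩)
    rw [Real.logb_rpow (by norm_num) (by norm_num)] at hlog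
    have : Real.logb 2 (t n) / n ≤ h := by
      rw [div_le_iff₀ hn']; linarith
    rw [Real.logb_mul ht'.ne' hP, add_div]
    linarith

/-- The average type enumerator at a single length bounds its growth rate from below, up to a
polynomial factor. -/
theorem le_typeGrowth [NeZero q] (hdv : 1 ≤ dv) (hdc : 1 ≤ dc) (hn : 1 ≤ n) {θ : TypeVec q}
    (h : 0 < avgTypeEnum dv dc n θ) :
    ((Real.logb 2 (avgTypeEnum dv dc n θ / (3 * ((n * dv : ℕ) + 1)) ^ (2 * (q / 2 + 1))) / n : ℝ)
      : EReal) ≤ typeGrowth dv dc θ := by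
  refine le_growthRate hn (by positivity) fun k hk => ?_
  rw [avgTypeEnum_eq] at h
  obtain ⟨ω, -, hf, ha, hle⟩ := exists_dominant_edgeType hdv hn (right_ne_zero_of_mul h.ne')
  set c : ℝ := (3 * ((n * dv : ℕ) + 1)) ^ (q / 2 + 1) with hc
  have hcpos : 0 < c := by positivity
  have hT := ncard_typeClass_pow_le (n := n) hk θ
  have hT' : ((typeClass (Fin n) θ).ncard : ℝ) ^ k ≤ (typeClass (Fin (k * n)) θ).ncard := by
    exact_mod_cast hT
  have hf' := typeTransition_pow_le (dv := dv) (n := n) hdc hk ω θ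
  have ha' := checkProb_div_pow_le hdv hdc hn hk hf
  rw [← hc] at ha'
  have hv : avgTypeEnum dv dc n θ / (3 * ((n * dv : ℕ) + 1)) ^ (2 * (q / 2 + 1))
      ≤ (typeClass (Fin n) θ).ncard
        * (typeTransition dv dc n ω θ * (checkProb dv dc n ω / c)) := by
    rw [avgTypeEnum_eq, mul_comm 2 (q / 2 + 1), pow_mul, ← hc, div_le_iff₀ (by positivity)]
    refine (mul_le_mul_of_nonneg_left hle (Nat.cast_nonneg _)).trans (le_of_eq ?_)
    field_simp
  calc (avgTypeEnum dv dc n θ / (3 * ((n * dv : ℕ) + 1)) ^ (2 * (q / 2 + 1))) ^ k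
      ≤ ((typeClass (Fin n) θ).ncard
        * (typeTransition dv dc n ω θ * (checkProb dv dc n ω / c))) ^ k :=
        pow_le_pow_left₀ (div_nonneg (avgTypeEnum_nonneg θ) (by positivity)) hv k
    _ = ((typeClass (Fin n) θ).ncard : ℝ) ^ k
        * (typeTransition dv dc n ω θ ^ k * (checkProb dv dc n ω / c) ^ k) := by
        rw [mul_pow, mul_pow]
    _ ≤ (typeClass (Fin (k * n)) θ).ncard
        * (typeTransition dv dc (k * n) ω θ * checkProb dv dc (k * n) ω) := by
        gcongr
        exact condProb_nonneg _ _
    _ ≤ (typeClass (Fin (k * n)) θ).ncard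
        * condProb (checksHold q dv dc (k * n)) (inputType dv dc (k * n) θ) := by
        gcongr
        exact typeTransition_mul_checkProb_le ω θ
    _ = avgTypeEnum dv dc (k * n) θ := (avgTypeEnum_eq θ).symm

theorem weightGrowth_le [NeZero q] (hdv : 1 ≤ dv) (hdc : 1 ≤ dc) (δ : ℝ) :
    weightGrowth q dv dc δ ≤
      ⨆ θ ∈ {θ ∈ allLeeTypes q | typeWeight θ = δ}, typeGrowth dv dc θ := by
  classical
  refine growthRate_le (tendsto_logb_poly_div (3 * (q / 2 + 1)) dv hdv) fun n hn hF => ?_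
  have hn' : (0 : ℝ) < n := by exact_mod_cast hn
  rw [avgWeightEnum_eq_sum] at hF ⊢
  set s := (typesOf q (Fin n)).filter fun θ => n * typeWeight θ = δ * n with hs
  have hne : s.Nonempty := Finset.nonempty_of_sum_ne_zero hF
  obtain ⟨θ, hθ, hmax⟩ := Finset.exists_max_image s (fun θ => avgTypeEnum dv dc n θ) hne
  have hpos : 0 < ∑ θ ∈ s, avgTypeEnum dv dc n θ :=
    lt_of_le_of_ne (Finset.sum_nonneg fun θ _ => avgTypeEnum_nonneg θ) hF.symm
  set b : ℝ := 3 * ((n * dv : ℕ) + 1) with hb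
  have hbpos : 0 < b := by positivity
  have hle : ∑ θ ∈ s, avgTypeEnum dv dc n θ ≤ b ^ (q / 2 + 1) * avgTypeEnum dv dc n θ := by
    refine (Finset.sum_le_card_nsmul _ _ _ hmax).trans ?_
    rw [nsmul_eq_mul]
    refine mul_le_mul_of_nonneg_right ?_ (avgTypeEnum_nonneg θ)
    have hc := (Finset.card_filter_le (typesOf q (Fin n)) fun θ => n * typeWeight θ = δ * n).trans
      (card_typesOf_le (q := q) (ι := Fin n))
    rw [Fintype.card_fin] at hc
    refine le_trans (by exact_mod_cast hc : _ ≤ ((n : ℝ) + 1) ^ (q / 2 + 1))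
      (pow_le_pow_left₀ (by positivity) ?_ _)
    have : (n : ℝ) ≤ ((n * dv : ℕ) : ℝ) := by exact_mod_cast Nat.le_mul_of_pos_right n hdv
    linarith
  have hA : 0 < avgTypeEnum dv dc n θ := by
    refine lt_of_le_of_ne (avgTypeEnum_nonneg θ) fun h0 => ?_
    rw [← h0, mul_zero] at hle
    exact hle.not_gt hpos
  have hmem := Finset.mem_filter.1 hθ
  refine ⟨Real.logb 2 (avgTypeEnum dv dc n θ / b ^ (2 * (q / 2 + 1))) / n, ?_, ?_⟩
  · refine (le_typeGrowth hdv hdc hn hA).trans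
      (le_iSup₂ (f := fun θ _ => typeGrowth dv dc θ) θ ⟨⟨n, hn, mem_typesOf.1 hmem.1⟩, ?_⟩)
    have := hmem.2
    rw [mul_comm] at this
    exact mul_right_cancel₀ hn'.ne' this
  · have hlog := Real.logb_le_logb_of_le (b := 2) (by norm_num) hpos hle
    rw [Real.logb_mul (by positivity) hA.ne', Real.logb_pow] at hlog
    rw [Real.logb_div hA.ne' (by positivity), Real.logb_pow, ← add_div]
    gcongr
    refine hlog.trans (le_of_eq ?_)
    push_cast
    ring

end Bounds

end LeeLDPC

end

theorem mainTheorem11 (q dv dc : ℕ) [NeZero q] (hdv : 1 ≤ dv) (hdc : 1 ≤ dc) :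
    (∀ θ ∈ LeeLDPC.allLeeTypes q,
      (LeeLDPC.growthRate (fun n => LeeLDPC.patternEnum dv dc n θ) ≤
          (LeeLDPC.entropy θ : EReal) +
            (⨆ ω ∈ LeeLDPC.allEdgeTypes dv θ, (LeeLDPC.phi dv dc ω θ + LeeLDPC.alpha dv dc ω))) ∧
      (LeeLDPC.typeGrowth dv dc θ ≤
          ((LeeLDPC.entropy θ + LeeLDPC.hatFrac θ : ℝ) : EReal) +
            (⨆ ω ∈ LeeLDPC.allEdgeTypes dv θ,
              (LeeLDPC.phi dv dc ω θ + LeeLDPC.alpha dv dc ω)))) ∧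
    ∀ δ : ℝ, LeeLDPC.weightGrowth q dv dc δ ≤
      ⨆ θ ∈ {θ ∈ LeeLDPC.allLeeTypes q | LeeLDPC.typeWeight θ = δ},
        LeeLDPC.typeGrowth dv dc θ := by
  refine ⟨fun θ hθ => ⟨?_, ?_⟩, LeeLDPC.weightGrowth_le hdv hdc⟩
  · refine LeeLDPC.growthRate_le_add_iSup hdv hdc θ (fun _ => Nat.cast_nonneg _) ?_
    rintro n hn ⟨x, rfl⟩
    have : Nonempty (Fin n) := ⟨⟨0, hn⟩⟩
    simpa using LeeLDPC.typeMultinomial_le x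
  · have h := LeeLDPC.growthRate_le_add_iSup (q := q) hdv hdc θ
      (t := fun n => ((LeeLDPC.typeClass (Fin n) θ).ncard : ℝ))
      (h := LeeLDPC.entropy θ + LeeLDPC.hatFrac θ) (fun _ => Nat.cast_nonneg _) ?_
    · simpa only [LeeLDPC.typeGrowth, LeeLDPC.avgTypeEnum_eq] using h
    · rintro n hn ⟨x, rfl⟩
      have : Nonempty (Fin n) := ⟨⟨0, hn⟩⟩
      refine (LeeLDPC.ncard_typeClass_le _).trans ?_
      rw [Fintype.card_fin]
      gcongr
      · norm_num
      · exact LeeLDPC.classRate_le (LeeLDPC.leeType_nonneg x) (LeeLDPC.sum_leeType x)
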